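/- Let $K$ be a field and let $K_0(\mathcal V_K)$ be the Grothendieck ring of varieties over $K$, i.e. the abelian group generated by the isomorphism classes $[X]$ of varieties over $K$ (separated schemes of finite type over $K$) with the relations $[X]=[Y]+[X\smallsetminus Y]$ for $Y\subset X$ a closed subvariety, with the product $[X]\cdot[Y]=[X\times_K Y]$. Let $\mathbb T=[\mathbb A^1\smallsetminus\{0\}]\in K_0(\mathcal V_K)$. For a finite connected graph $G$ (with parallel edges allowed) with edge set $E$, let $\Psi_G=\sum_{S}\prod_{e\notin S}t_e\in K[t_e:e\in E]$, where $S$ ranges over the spanning trees of $G$, and let $\mathbb U(G)=[\mathbb A^{E}\smallsetminus\{\Psi_G=0\}]\in K_0(\mathcal V_K)$. The $(1,3,1)$-bananification of an edge of a graph replaces this edge by a string consisting of a single edge, three parallel edges and a single edge (with two new inner vertices). * $\Gamma_n$ is the graph obtained from a single edge by $n$ successive $(1,3,1)$-bananifications, each of them after the first being performed on one of the three parallel edges produced by the preceding one. * $\Gamma'_n$ ($n\ge 2$) is the graph obtained from two vertices joined by four parallel edges by $n-2$ successive $(1,3,1)$-bananifications, the first performed on one of the four edges, and each of the following on one of the three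 parallel edges produced by the preceding one. (It is a closed string of $n$ circles, each meeting the next one at two points.) * $\Sigma^s_n$ ($s,n\ge1$) is the star with $s$ rays and $n$ circles along each ray: $\Sigma^s_1$ is the closed cyclic chain in which $s$ triple edges alternate with $s$ single edges, and $\Sigma^s_n$ is obtained from it by performing on each of the $s$ triple edges $n-1$ successive $(1,3,1)$-bananifications, the first on one of its three edges, and each of the following on one of the three parallel edges produced by the preceding one. Let $\sigma^s_n(t)\in\mathbb Z[t]$ be the polynomials defined by $$\frac{1-2r+((s-1)t-(s-2))r^2}{1-(2+t)r+2r^2}=1+\sum_{n\ge0}\sigma^s_n(t)\,r^{n+1}.$$ Then, for all integers $s,n\ge1$: 1. If $s\le 2n$, then $\mathbb U(\Sigma^s_n)=\mathbb T^n(\mathbb T+1)^{2n-s}\,\mathbb U(\Gamma_n)^{s-1}\,\sigma^s_n(\mathbb T)$. If $s\ge 2n$, then $(\mathbb T+1)^{s-2n}\,\mathbb U(\Sigma^s_n)=\mathbb T^n\,\mathbb U(\Gamma_n)^{s-1}\,\sigma^s_n(\mathbb T)$. 2. If $s\le 2n$, then $\mathbb U(\Gamma_n)^{s-1}$ divides $\mathbb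 U(\Sigma^s_n)$, with a quotient that is a polynomial in $\mathbb T$ with integer coefficients. 3. $\mathbb U(\Gamma_n)$ divides $\mathbb U(\Gamma'_{2n+1})$, with a quotient that is a polynomial in $\mathbb T$ with integer coefficients. -/

import Mathlib

open CategoryTheory AlgebraicGeometry

/-! ### Finite multigraphs and their Kirchhoff--Symanzik polynomials -/

/-- A finite multigraph (parallel edges and loops are allowed). Each edge carries an auxiliary
orientation, from `src e` to `tgt e`. -/
structure Multigraph where
  V : Type
  E : Type
  [finite_V : Finite V]
  [finite_E : Finite E]
  src : E → V
  tgt : E → V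

attribute [instance] Multigraph.finite_V Multigraph.finite_E

namespace Multigraph

/-- `u` and `v` are joined by a path that uses only edges of `S` (in either direction). -/
def Joined (G : Multigraph) (S : Set G.E) : G.V → G.V → Prop :=
  Relation.EqvGen fun u v => ∃ e ∈ S, G.src e = u ∧ G.tgt e = v

/-- The edges of `S`, together with all the vertices of `G`, form a tree: this subgraph is
connected, and it has no cycle (no edge of `S` has its ends joined by the other edges of `S`). -/
def IsSpanningTree (G : Multigraph) (S : Set G.E) : Prop :=
  (∀ u v, G.Joined S u v) ∧ ∀ e ∈ S, ¬ G.Joined (S \ {e}) (G.src e) (G.tgt e)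

open Classical in
/-- The Kirchhoff--Symanzik polynomial `∑_T ∏_{e ∉ T} t_e`, the sum being over the spanning
trees `T` of `G`. -/
noncomputable def kirchhoff (G : Multigraph) (K : Type*) [Field K] : MvPolynomial G.E K :=
  letI : Fintype G.E := Fintype.ofFinite G.E
  ∑ S ∈ Finset.univ.filter (fun S : Finset G.E => G.IsSpanningTree ↑S), ∏ e ∈ (Sᶜ : Finset G.E), MvPolynomial.X e

end Multigraph

/-! ### Bananification, and the three families of melonic graphs -/

/-- A multigraph with distinct marked edges, indexed by `ι`. -/
structure MarkedGraph (ι : Type) extends Multigraph where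
  mark : ι ↪ E

namespace MarkedGraph

/-- The `(1,3,1)`-bananification of every marked edge: for each `i : ι`, the marked edge
`mark i` is removed and replaced by a string consisting of a single edge (number `0`), a
`3`-banana (edges `1`, `2`, `3`) and a single edge (number `4`); this string has two new inner
vertices, `(i, false)` and `(i, true)`. In the new graph, one of the three parallel edges of
each of the new `3`-bananas is marked. -/
def bananify {ι : Type} [Finite ι] (G : MarkedGraph ι) : MarkedGraph ι where
  V := G.V ⊕ ι × Bool
  E := {e : G.E // e ∉ Set.range G.mark} ⊕ ι × Fin 5
  src
    | .inl e => .inl (G.src e.1)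
    | .inr (i, k) =>
      ![.inl (G.src (G.mark i)), .inr (i, false), .inr (i, false), .inr (i, false),
        .inr (i, true)] k
  tgt
    | .inl e => .inl (G.tgt e.1)
    | .inr (i, k) =>
      ![.inr (i, false), .inr (i, true), .inr (i, true), .inr (i, true),
        .inl (G.tgt (G.mark i))] k
  mark := ⟨fun i => .inr (i, 2), fun i j h => by simpa using h⟩

/-- A single edge joining two vertices, marked. -/
def singleEdge : MarkedGraph Unit where
  V := Bool
  E := Unit
  src _ := false
  tgt _ := true
  mark := Function.Embedding.refl Unit

/-- The `4`-banana (two vertices joined by four parallel edges), with one marked edge. -/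
def fourBanana : MarkedGraph Unit where
  V := Bool
  E := Fin 4
  src _ := false
  tgt _ := true
  mark := ⟨fun _ => 0, fun _ _ _ => rfl⟩

/-- The closed cyclic chain `3,1,3,1,…,3,1` of `s` triple edges alternating with `s` single
edges, with one edge marked in each of the triple edges. For each `i`, the edges
`(i, 0), (i, 1), (i, 2)` join the vertices `(i, false)` and `(i, true)`, and the edge `(i, 3)`
joins the vertices `(i, true)` and `(i + 1, false)`, the index `i` being taken modulo `s`.
It is a circle meeting `s` pairwise disjoint circles at two points each: the central circle
consists of the `s` single edges and of one edge from each of the triple edges, and the other two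
edges of the `i`-th triple edge form the `i`-th of the surrounding circles. -/
def necklace (s : ℕ) : MarkedGraph (Fin s) where
  V := Fin s × Bool
  E := Fin s × Fin 4
  src e := (e.1, ![false, false, false, true] e.2)
  tgt e := (![e.1, e.1, e.1, finRotate s e.1] e.2, ![true, true, true, false] e.2)
  mark := ⟨fun i => (i, 0), fun i j h => by simpa using h⟩

end MarkedGraph

namespace Multigraph

/-- The graph `Γ_n`, a chain of `n` interlocked circles with two external edges: apply `n` times
the `(1,3,1)`-bananification, starting with a single edge and then each time with one of the three
parallel edges that were produced last. -/
def Gamma (n : ℕ) : Multigraph :=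
  (MarkedGraph.bananify^[n] MarkedGraph.singleEdge).toMultigraph

/-- The vacuum graph `Γ'_n`, for `n ≥ 2`, a chain of `n` interlocked circles: apply `n - 2` times
the `(1,3,1)`-bananification, starting with an edge of a `4`-banana and then each time with one of
the three parallel edges that were produced last. -/
def GammaVac (n : ℕ) : Multigraph :=
  (MarkedGraph.bananify^[n - 2] MarkedGraph.fourBanana).toMultigraph

/-- The vacuum star `Σ^s_n`, for `s, n ≥ 1`: a central circle from which `s` rays start, each of
them a chain of `n` interlocked circles. The necklace is the case `n = 1`; a further circle is
added to each of the `s` rays by the `(1,3,1)`-bananification of one of the three parallel edges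
at the end of this ray. -/
def Star (s n : ℕ) : Multigraph :=
  (MarkedGraph.bananify^[n - 1] (MarkedGraph.necklace s)).toMultigraph

end Multigraph

/-! ### The Grothendieck ring of varieties -/

universe u

/-- A variety over `K`: a separated scheme of finite type over `K`. -/
structure Variety (K : Type u) [Field K] where
  obj : Over (Spec (.of K))
  isSeparated : IsSeparated obj.hom
  locallyOfFiniteType : LocallyOfFiniteType obj.hom
  quasiCompact : QuasiCompact obj.hom

/-- The relations that define the Grothendieck ring of varieties. -/
inductive K0Rel (K : Type u) [Field K] :
    FreeCommRing (Variety K) → FreeCommRing (Variety K) → Prop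
  /-- Isomorphic varieties have the same class. -/
  | iso (X Y : Variety K) (i : X.obj ≅ Y.obj) : K0Rel K (.of X) (.of Y)
  /-- `[X] = [Z] + [U]` if `Z` is a closed subvariety of `X` with complement `U`. -/
  | scissor (X Z U : Variety K) (i : Z.obj ⟶ X.obj) (j : U.obj ⟶ X.obj)
      (hi : IsClosedImmersion i.left) (hj : IsOpenImmersion j.left)
      (h : (Set.range i.left)ᶜ = Set.range j.left) :
      K0Rel K (.of X) (.of Z + .of U)
  /-- `[X ×_K Y] = [X] · [Y]`. -/
  | prod (X Y P : Variety K) (p : P.obj ⟶ X.obj) (q : P.obj ⟶ Y.obj)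
      (h : IsPullback p.left q.left X.obj.hom Y.obj.hom) :
      K0Rel K (.of P) (.of X * .of Y)
  /-- The class of the point `Spec K` is `1`. -/
  | one (X : Variety K) (i : X.obj ≅ Over.mk (𝟙 (Spec (.of K)))) : K0Rel K (.of X) 1

/-- The Grothendieck ring of varieties over `K`, by generators and relations. Since products of
classes of varieties are classes of varieties, its additive group is the abelian group that is
generated by the isomorphism classes of varieties with the scissor relations. -/
def K0 (K : Type u) [Field K] : Type (u + 1) := RingQuot (K0Rel K)

noncomputable instance (K : Type u) [Field K] : CommRing (K0 K) :=
  inferInstanceAs (CommRing (RingQuot (K0Rel K)))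

/-- The class of a variety in the Grothendieck ring. -/
noncomputable def Variety.cls {K : Type u} [Field K] (X : Variety K) : K0 K :=
  RingQuot.mkRingHom (K0Rel K) (.of X)

/-- The affine space over `K` with coordinates indexed by `σ`. -/
noncomputable abbrev affineSpec (K : Type u) [Field K] (σ : Type) : Scheme.{u} :=
  Spec (.of (MvPolynomial σ K))

/-- The structure morphism of the affine space. -/
noncomputable abbrev affineSpecHom (K : Type u) [Field K] (σ : Type) :
    affineSpec K σ ⟶ Spec (.of K) :=
  Spec.map (CommRingCat.ofHom (MvPolynomial.C (R := K) (σ := σ)))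

/-- The open subset of the affine space where `f` does not vanish. -/
noncomputable abbrev nonvanishing (K : Type u) [Field K] (σ : Type) (f : MvPolynomial σ K) :
    (affineSpec K σ).Opens :=
  PrimeSpectrum.basicOpen f

/-- The complement of the affine hypersurface `f = 0` in the affine space over `K` with
coordinates indexed by `σ`, as an open subscheme of `Spec K[t_i : i ∈ σ]`. -/
noncomputable def hypersurfaceCompl (K : Type u) [Field K] (σ : Type) [Finite σ]
    (f : MvPolynomial σ K) : Variety K where
  obj := Over.mk ((nonvanishing K σ f).ι ≫ affineSpecHom K σ)
  isSeparated := by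
    dsimp only [Over.mk_hom]; infer_instance
  locallyOfFiniteType := by
    have : LocallyOfFiniteType (affineSpecHom K σ) := by
      rw [HasRingHomProperty.Spec_iff (P := @LocallyOfFiniteType)]
      change (algebraMap K (MvPolynomial σ K)).FiniteType
      rw [RingHom.finiteType_algebraMap]
      infer_instance
    dsimp only [Over.mk_hom]; infer_instance
  quasiCompact := by
    have : IsNoetherianRing (MvPolynomial σ K) := inferInstance
    have : QuasiCompact (nonvanishing K σ f).ι := by
      infer_instance
    dsimp only [Over.mk_hom]; infer_instance

/-- The class `𝕋` of `𝔸¹ ∖ {0}`. -/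
noncomputable def torusClass (K : Type u) [Field K] : K0 K :=
  (hypersurfaceCompl K Unit (MvPolynomial.X ())).cls

/-- The Grothendieck class `𝕌(G)` of a graph: the class of the complement, in the affine space
with one coordinate for each edge of `G`, of the hypersurface defined by the Kirchhoff--Symanzik
polynomial of `G`. -/
noncomputable def grothendieckClass (K : Type u) [Field K] (G : Multigraph) : K0 K :=
  (hypersurfaceCompl K G.E (G.kirchhoff K)).cls

/-! ### The polynomials `σ^s_n` -/

open Polynomial in
/-- The denominator `1 - (2 + t) r + 2 r²`, as a power series in `r` over `ℤ[t]`. -/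
noncomputable def starDen : PowerSeries ℤ[X] :=
  1 - PowerSeries.C (2 + X) * PowerSeries.X + 2 * PowerSeries.X ^ 2

open Polynomial in
/-- The numerator `1 - 2 r + ((s - 1) t - (s - 2)) r²`, as a power series in `r` over `ℤ[t]`. -/
noncomputable def starNum (s : ℕ) : PowerSeries ℤ[X] :=
  1 - 2 * PowerSeries.X + PowerSeries.C (((s : ℤ[X]) - 1) * X - ((s : ℤ[X]) - 2)) *
    PowerSeries.X ^ 2

/-- The quotient of the two power series, with `starSeries_mul_starDen`. -/
noncomputable def starSeries (s : ℕ) : PowerSeries (Polynomial ℤ) :=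
  starNum s * PowerSeries.invOfUnit starDen 1

theorem starSeries_mul_starDen (s : ℕ) : starSeries s * starDen = starNum s := by
  have h : starDen * PowerSeries.invOfUnit starDen 1 = 1 :=
    PowerSeries.mul_invOfUnit _ _ (by simp [starDen])
  rw [starSeries, mul_assoc, mul_comm _ starDen, h, mul_one]

/-- The polynomial `σ^s_n(t)`, the coefficient of `r^(n+1)` in the expansion of
`(1 - 2 r + ((s - 1) t - (s - 2)) r²) / (1 - (2 + t) r + 2 r²)`. -/
noncomputable def starPoly (s n : ℕ) : Polynomial ℤ :=
  PowerSeries.coeff (n + 1) (starSeries s)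

/-! Every graph here is assembled from two-terminal networks. Such a network carries a pair `(a,
b)`: `b` is its Kirchhoff polynomial, `a` the one obtained by identifying the terminals. An edge `x`
in series changes the pair to `(a + b x, b)`, an edge in parallel to `(a x, a + b x)`. A marked edge
enters the homogeneous polynomial `treePoly` through such a pair, and bananification substitutes the
pair of a string (`treePoly_bananify`, `exists_edgeEquiv_iterate`).

All these polynomials are linear in the newest variable. Splitting along the vanishing of its
coefficient (`complClass_linear`) shows that the classes `α`, `β`, `π` of the loci `a ≠ 0`, `b ≠ 0`,
`a b ≠ 0` change linearly under both operations. From one circle to the next only `β` and `δ = α -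
π` matter. Up to powers of `𝕋` and `𝕋 + 1` they are a pair `(b_n, g_n)`, namely `chainBG n`,
transformed by the matrix with rows `(𝕋 + 1, 1)` and `(𝕋 - 1, 1)` (`genericCircle_hasClasses`). Its
trace `2 + 𝕋` and determinant `2` are the coefficients of the denominator of the generating series,
whence `σ^s_n = t b_n + s g_n` (`starPoly_eq`).

The graph `Γ_n` is a chain of circles with two bridges, so its class is `(𝕋 + 1)² β`. The star
closes up `s` such chains, each followed by a single edge. Where its polynomial is nonzero, either
no `b_j` vanishes or exactly one does, and the class is `((𝕋 + 1) β)^(s-1) (𝕋 β + s (𝕋 + 1) δ)`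
(`complClass_closedChain`). Comparing the two gives the assertions on stars. The class of
`Γ'_{2n+1}` is a monomial in `𝕋` and `𝕋 + 1` times `𝕋 b_{2n} + g_{2n}`, which equals `b_n (𝕋 b_n + 2
g_n)` (`chainBG_add`). -/

/-! ### Classes of affine varieties -/

section AffineClass

variable (K : Type u) [Field K]

/-- The spectrum of a finitely generated `K`-algebra, as a variety. -/
noncomputable def affineVariety (A : Type u) [CommRing A] [Algebra K A]
    [Algebra.FiniteType K A] : Variety K where
  obj := Over.mk (Spec.map (CommRingCat.ofHom (algebraMap K A)))
  isSeparated := by dsimp only [Over.mk_hom]; infer_instance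
  locallyOfFiniteType := by
    dsimp only [Over.mk_hom]
    rw [HasRingHomProperty.Spec_iff (P := @LocallyOfFiniteType)]
    change (algebraMap K A).FiniteType
    rw [RingHom.finiteType_algebraMap]
    infer_instance
  quasiCompact := by dsimp only [Over.mk_hom, Over.mk_left]; infer_instance

/-- The class of the spectrum of a finitely generated `K`-algebra. -/
noncomputable def affineClass (A : Type u) [CommRing A] [Algebra K A]
    [Algebra.FiniteType K A] : K0 K := (affineVariety K A).cls

variable {K}

theorem Variety.cls_eq_of_iso {X Y : Variety K} (i : X.obj ≅ Y.obj) : X.cls = Y.cls :=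
  RingQuot.mkRingHom_rel (K0Rel.iso X Y i)

section

variable {A B : Type u} [CommRing A] [Algebra K A] [Algebra.FiniteType K A]
  [CommRing B] [Algebra K B] [Algebra.FiniteType K B]

theorem affineClass_congr (e : A ≃ₐ[K] B) : affineClass K A = affineClass K B := by
  refine Variety.cls_eq_of_iso (Over.isoMk (Scheme.Spec.mapIso
    (e.symm.toRingEquiv.toCommRingCatIso).op) ?_)
  change Spec.map _ ≫ Spec.map _ = Spec.map _
  rw [← Spec.map_comp]
  congr 1
  ext x
  simp

theorem affineClass_eq_add (g : A) :
    affineClass K A = affineClass K (A ⧸ Ideal.span {g}) + affineClass K (Localization.Away g) := by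
  have h := RingQuot.mkRingHom_rel (K0Rel.scissor (affineVariety K A)
    (affineVariety K (A ⧸ Ideal.span {g})) (affineVariety K (Localization.Away g))
    (Over.homMk (Spec.map (CommRingCat.ofHom (Ideal.Quotient.mk (Ideal.span {g})))) (by
      change Spec.map _ ≫ Spec.map _ = Spec.map _
      rw [← Spec.map_comp]; rfl))
    (Over.homMk (Spec.map (CommRingCat.ofHom (algebraMap A (Localization.Away g)))) (by
      change Spec.map _ ≫ Spec.map _ = Spec.map _
      rw [← Spec.map_comp, ← CommRingCat.ofHom_comp, ← IsScalarTower.algebraMap_eq]))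
    (show IsClosedImmersion (Spec.map (CommRingCat.ofHom (Ideal.Quotient.mk (Ideal.span {g})))) from
      IsClosedImmersion.spec_of_quotient_mk (R := .of A) _)
    (show IsOpenImmersion (Spec.map (CommRingCat.ofHom (algebraMap A (Localization.Away g)))) from
      inferInstance) ?_)
  · rw [map_add] at h
    exact h
  · change (Set.range (PrimeSpectrum.comap (Ideal.Quotient.mk (Ideal.span {g}))))ᶜ =
      Set.range (PrimeSpectrum.comap (algebraMap A (Localization.Away g)))
    rw [PrimeSpectrum.localization_away_comap_range _ g,
      range_comap_of_surjective _ _ Ideal.Quotient.mk_surjective,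
      Ideal.mk_ker, PrimeSpectrum.zeroLocus_span, PrimeSpectrum.basicOpen_eq_zeroLocus_compl]

open TensorProduct in
theorem finiteType_tensorProduct : Algebra.FiniteType K (A ⊗[K] B) :=
  Algebra.FiniteType.trans (S := A) inferInstance inferInstance

open TensorProduct in
theorem affineClass_tensorProduct [Algebra.FiniteType K (A ⊗[K] B)] :
    affineClass K (A ⊗[K] B) = affineClass K A * affineClass K B := by
  have h := RingQuot.mkRingHom_rel (K0Rel.prod (affineVariety K A) (affineVariety K B)
    (affineVariety K (A ⊗[K] B))
    (Over.homMk (Spec.map (CommRingCat.ofHom (algebraMap A (A ⊗[K] B)))) (by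
      change Spec.map _ ≫ Spec.map _ = Spec.map _
      rw [← Spec.map_comp, ← CommRingCat.ofHom_comp, ← IsScalarTower.algebraMap_eq]))
    (Over.homMk (Spec.map (CommRingCat.ofHom
        (Algebra.TensorProduct.includeRight : B →ₐ[K] A ⊗[K] B).toRingHom)) (by
      change Spec.map _ ≫ Spec.map _ = Spec.map _
      rw [← Spec.map_comp, ← CommRingCat.ofHom_comp]
      congr 2
      exact (Algebra.TensorProduct.includeRight : B →ₐ[K] A ⊗[K] B).comp_algebraMap))
    (isPullback_SpecMap_of_isPushout _ _ _ _ (CommRingCat.isPushout_tensorProduct K A B)))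
  rw [map_mul] at h
  exact h

end

theorem affineClass_self : affineClass K K = 1 := by
  refine (RingQuot.mkRingHom_rel (K0Rel.one _ (Over.isoMk (Iso.refl _) ?_))).trans (map_one _)
  change 𝟙 _ ≫ 𝟙 _ = Spec.map (CommRingCat.ofHom (algebraMap K K))
  rw [Category.comp_id]
  exact Spec.map_id _ |>.symm

end AffineClass

/-! ### Classes of complements of hypersurfaces in affine spaces -/

section ComplClass

open MvPolynomial

variable {K : Type u} [Field K] {σ τ : Type} [Finite σ] [Finite τ]

/-- The class of the complement of the hypersurface `f = 0` in affine space. -/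
noncomputable def complClass (f : MvPolynomial σ K) : K0 K := (hypersurfaceCompl K σ f).cls

theorem complClass_eq_affineClass (f : MvPolynomial σ K) :
    complClass f = affineClass K (Localization.Away f) := by
  refine Variety.cls_eq_of_iso (Over.isoMk (basicOpenIsoSpecAway (R := .of (MvPolynomial σ K)) f) ?_)
  change _ ≫ Spec.map (CommRingCat.ofHom (algebraMap K (Localization.Away f))) =
    (nonvanishing K σ f).ι ≫ affineSpecHom K σ
  rw [IsScalarTower.algebraMap_eq K (MvPolynomial σ K), CommRingCat.ofHom_comp, Spec.map_comp,
    ← Category.assoc]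
  congr 1
  exact basicOpenIsoSpecAway_hom_SpecMap (R := .of (MvPolynomial σ K)) f

theorem complClass_congr (e : MvPolynomial σ K ≃ₐ[K] MvPolynomial τ K) (f : MvPolynomial σ K) :
    complClass (e f) = complClass f := by
  rw [complClass_eq_affineClass, complClass_eq_affineClass]
  have : IsLocalization.Away f (Localization.Away f) := inferInstance
  exact (affineClass_congr (IsLocalization.algEquivOfAlgEquiv (M := Submonoid.powers f)
    (T := Submonoid.powers (e f)) _ _ e (by simp [Submonoid.map_powers]))).symm

theorem complClass_rename (e : σ ≃ τ) (f : MvPolynomial σ K) :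
    complClass (rename e f) = complClass f :=
  complClass_congr (renameEquiv K e) f

/-- Only the underlying open set matters, so repeated factors can be dropped. -/
theorem complClass_sq_mul (f g : MvPolynomial σ K) :
    complClass (f * f * g) = complClass (f * g) := by
  have h : nonvanishing K σ (f * f * g) = nonvanishing K σ (f * g) := by
    rw [nonvanishing, nonvanishing, PrimeSpectrum.basicOpen_mul, PrimeSpectrum.basicOpen_mul,
      PrimeSpectrum.basicOpen_mul, inf_idem]
  refine Variety.cls_eq_of_iso (Over.isoMk ((affineSpec K σ).isoOfEq h) ?_)
  simp [hypersurfaceCompl]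

/-- The difference is the class of the locus `f ≠ 0`, `g = 0`. Localization commutes with quotients,
so this locus is the spectrum of a ring that sees `f` only modulo `g`. -/
theorem complClass_sub_eq_affineClass (f g : MvPolynomial σ K) :
    complClass f - complClass (f * g) =
      affineClass K (Localization.Away (Ideal.Quotient.mk (Ideal.span {g}) f)) := by
  let R := MvPolynomial σ K
  let A := Localization.Away f
  let g' : A := algebraMap R A g
  have h1 : affineClass K (Localization.Away g') = complClass (f * g) := by
    rw [complClass_eq_affineClass]
    have : IsLocalization.Away (f * g) (Localization.Away g') :=
      IsLocalization.Away.mul' A (Localization.Away g') f g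
    exact affineClass_congr ((IsLocalization.algEquiv (Submonoid.powers (f * g))
      (Localization.Away g') (Localization.Away (f * g))).restrictScalars K)
  rw [complClass_eq_affineClass f, affineClass_eq_add g', h1, add_sub_cancel_right]
  let I : Ideal R := Ideal.span {g}
  have hI : Ideal.span {g'} = I.map (algebraMap R A) := by
    rw [Ideal.map_span, Set.image_singleton]
  have h2 : IsLocalization.Away (Ideal.Quotient.mk I f) (A ⧸ I.map (algebraMap R A)) := by
    have h := (inferInstance : IsLocalization
      (Algebra.algebraMapSubmonoid (R ⧸ I) (Submonoid.powers f)) (A ⧸ I.map (algebraMap R A)))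
    rwa [Algebra.algebraMapSubmonoid, Submonoid.map_powers] at h
  let e := IsLocalization.algEquiv (Submonoid.powers (Ideal.Quotient.mk I f))
    (A ⧸ I.map (algebraMap R A)) (Localization.Away (Ideal.Quotient.mk I f))
  exact (affineClass_congr (Ideal.quotientEquivAlgOfEq K hI)).trans
    (affineClass_congr (AlgEquiv.ofRingEquiv (f := e.toRingEquiv) fun x =>
      (e.commutes (algebraMap K (R ⧸ I) x)).trans
        (IsScalarTower.algebraMap_apply K (R ⧸ I) (Localization.Away (Ideal.Quotient.mk I f)) x).symm))

/-- The class of the locus `f ≠ 0`, `g = 0` depends on the restriction of `f` to `g = 0` only. -/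
theorem complClass_sub_congr {f f' g : MvPolynomial σ K} (h : g ∣ f - f') :
    complClass f - complClass (f * g) = complClass f' - complClass (f' * g) := by
  rw [complClass_sub_eq_affineClass, complClass_sub_eq_affineClass,
    Ideal.Quotient.eq.mpr (Ideal.mem_span_singleton.mpr h)]

open TensorProduct in
/-- The complement of a product hypersurface in disjoint sets of variables is a product. -/
theorem complClass_rename_mul_rename (f : MvPolynomial σ K) (g : MvPolynomial τ K) :
    complClass (rename Sum.inl f * rename Sum.inr g) = complClass f * complClass g := by
  let h : MvPolynomial (σ ⊕ τ) K := rename Sum.inl f * rename Sum.inr g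
  let φ : MvPolynomial (σ ⊕ τ) K →ₐ[K] Localization.Away f ⊗[K] Localization.Away g :=
    aeval (Sum.elim (fun i => algebraMap (MvPolynomial σ K) (Localization.Away f) (X i) ⊗ₜ 1)
      (fun j => 1 ⊗ₜ algebraMap (MvPolynomial τ K) (Localization.Away g) (X j)))
  have hl : φ.comp (rename Sum.inl) = (Algebra.TensorProduct.includeLeft).comp
      (Algebra.algHom K (MvPolynomial σ K) (Localization.Away f)) := by
    ext i; simp [φ]; rfl
  have hr : φ.comp (rename Sum.inr) = (Algebra.TensorProduct.includeRight).comp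
      (Algebra.algHom K (MvPolynomial τ K) (Localization.Away g)) := by
    ext i; simp [φ]; rfl
  have hφ : IsUnit (φ h) := by
    have h1 := DFunLike.congr_fun hl f
    have h2 := DFunLike.congr_fun hr g
    simp only [AlgHom.comp_apply] at h1 h2
    rw [map_mul, h1, h2]
    exact ((IsLocalization.Away.algebraMap_isUnit f).map _).mul
      ((IsLocalization.Away.algebraMap_isUnit g).map _)
  have hu : IsUnit (algebraMap (MvPolynomial (σ ⊕ τ) K) (Localization.Away h) (rename Sum.inl f)) ∧
      IsUnit (algebraMap (MvPolynomial (σ ⊕ τ) K) (Localization.Away h) (rename Sum.inr g)) := by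
    rw [← IsUnit.mul_iff, ← map_mul]
    exact IsLocalization.Away.algebraMap_isUnit h
  let ι := Algebra.algHom K (MvPolynomial (σ ⊕ τ) K) (Localization.Away h)
  let Φ : Localization.Away h →ₐ[K] Localization.Away f ⊗[K] Localization.Away g :=
    IsLocalization.Away.liftAlgHom (f := φ) h hφ
  let ψf : Localization.Away f →ₐ[K] Localization.Away h :=
    IsLocalization.Away.liftAlgHom (f := ι.comp (rename Sum.inl)) f hu.1
  let ψg : Localization.Away g →ₐ[K] Localization.Away h :=
    IsLocalization.Away.liftAlgHom (f := ι.comp (rename Sum.inr)) g hu.2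
  have := finiteType_tensorProduct (K := K) (A := Localization.Away f) (B := Localization.Away g)
  rw [complClass_eq_affineClass, complClass_eq_affineClass, complClass_eq_affineClass,
    ← affineClass_tensorProduct]
  have hΦ : ∀ r, Φ (algebraMap _ _ r) = φ r := fun r => IsLocalization.Away.lift_eq h hφ r
  have hf : ∀ r, ψf (algebraMap _ _ r) = algebraMap _ _ (rename Sum.inl r : MvPolynomial (σ ⊕ τ) K) :=
    fun r => IsLocalization.Away.lift_eq f hu.1 r
  have hg : ∀ r, ψg (algebraMap _ _ r) = algebraMap _ _ (rename Sum.inr r : MvPolynomial (σ ⊕ τ) K) :=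
    fun r => IsLocalization.Away.lift_eq g hu.2 r
  have hc : ∀ x y, Commute (ψf x) (ψg y) := fun _ _ => Commute.all _ _
  refine affineClass_congr (AlgEquiv.ofAlgHom Φ (Algebra.TensorProduct.lift ψf ψg hc) ?_ ?_)
  · refine Algebra.TensorProduct.ext
      (IsLocalization.algHom_ext (Submonoid.powers f) (MvPolynomial.algHom_ext fun i => ?_))
      (IsLocalization.algHom_ext (Submonoid.powers g) (MvPolynomial.algHom_ext fun i => ?_))
    · change Φ (Algebra.TensorProduct.lift ψf ψg hc (algebraMap _ _ (X i) ⊗ₜ 1)) =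
        algebraMap _ _ (X i) ⊗ₜ 1
      rw [Algebra.TensorProduct.lift_tmul, hf, map_one, mul_one, hΦ, rename_X]
      simp [φ]
    · change Φ (Algebra.TensorProduct.lift ψf ψg hc (1 ⊗ₜ algebraMap _ _ (X i))) =
        1 ⊗ₜ algebraMap _ _ (X i)
      rw [Algebra.TensorProduct.lift_tmul, hg, map_one, one_mul, hΦ, rename_X]
      simp [φ]
  · refine IsLocalization.algHom_ext (Submonoid.powers h) (MvPolynomial.algHom_ext fun i => ?_)
    change Algebra.TensorProduct.lift ψf ψg hc (Φ (algebraMap _ _ (X i))) = algebraMap _ _ (X i)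
    rw [hΦ, aeval_X]
    rcases i with i | i
    · rw [Sum.elim_inl, Algebra.TensorProduct.lift_tmul, hf, map_one, mul_one, rename_X]
    · rw [Sum.elim_inr, Algebra.TensorProduct.lift_tmul, hg, map_one, one_mul, rename_X]

/-- A criterion for isomorphic complements. The last two hypotheses quantify over all extensions of
`φ` and `ψ` to the localizations, so the round trips can be checked on variables without unfolding a
lift. -/
theorem complClass_congr_of_away {f : MvPolynomial σ K} {g : MvPolynomial τ K}
    (φ : MvPolynomial σ K →ₐ[K] Localization.Away g)
    (ψ : MvPolynomial τ K →ₐ[K] Localization.Away f) (hφ : IsUnit (φ f)) (hψ : IsUnit (ψ g))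
    (h₁ : ∀ Φ : Localization.Away f →ₐ[K] Localization.Away g,
      (∀ r, Φ (algebraMap _ _ r) = φ r) →
      ∀ i, Φ (ψ (X i)) = algebraMap (MvPolynomial τ K) _ (X i))
    (h₂ : ∀ Ψ : Localization.Away g →ₐ[K] Localization.Away f,
      (∀ r, Ψ (algebraMap _ _ r) = ψ r) →
      ∀ i, Ψ (φ (X i)) = algebraMap (MvPolynomial σ K) _ (X i)) :
    complClass f = complClass g := by
  rw [complClass_eq_affineClass, complClass_eq_affineClass]
  let Φ : Localization.Away f →ₐ[K] Localization.Away g := IsLocalization.Away.liftAlgHom f hφ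
  let Ψ : Localization.Away g →ₐ[K] Localization.Away f := IsLocalization.Away.liftAlgHom g hψ
  have hΦ : ∀ r, Φ (algebraMap _ _ r) = φ r := fun r => IsLocalization.Away.lift_eq f hφ r
  have hΨ : ∀ r, Ψ (algebraMap _ _ r) = ψ r := fun r => IsLocalization.Away.lift_eq g hψ r
  refine affineClass_congr (AlgEquiv.ofAlgHom Φ Ψ ?_ ?_)
  · refine IsLocalization.algHom_ext (Submonoid.powers g) (MvPolynomial.algHom_ext fun i => ?_)
    exact (congrArg Φ (hΨ _)).trans (h₁ Φ hΦ i)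
  · refine IsLocalization.algHom_ext (Submonoid.powers f) (MvPolynomial.algHom_ext fun i => ?_)
    exact (congrArg Ψ (hΦ _)).trans (h₂ Ψ hΨ i)

/-- The affine change of coordinate `t ↦ t + G / F` over the locus `F ≠ 0`. -/
theorem complClass_linear_mul (F G : MvPolynomial σ K) :
    complClass ((X none * rename some F + rename some G) * rename some F) =
      complClass (X none * rename some F) := by
  let f : MvPolynomial (Option σ) K := (X none * rename some F + rename some G) * rename some F
  let g : MvPolynomial (Option σ) K := X none * rename some F
  -- The substitution `t ↦ t + c G / F`, recorded after multiplication by `F` to avoid the inverse.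
  -- It is used with `c = -1` and `c = 1`, which are mutually inverse.
  have key : ∀ h : MvPolynomial (Option σ) K, rename some F ∣ h → ∀ c : K, ∃ φ : MvPolynomial (Option σ) K →ₐ[K] Localization.Away h,
      (∀ p : MvPolynomial σ K, φ (rename some p) = algebraMap (MvPolynomial (Option σ) K) _ (rename some p)) ∧
      φ (X none) * algebraMap (MvPolynomial (Option σ) K) _ (rename some F) =
        algebraMap (MvPolynomial (Option σ) K) _ (X none * rename some F + C c * rename some G) := by
    intro h hF c
    obtain ⟨v, hv⟩ := (IsLocalization.Away.isUnit_of_dvd (S := Localization.Away h) h hF)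
    refine ⟨aeval (fun i => i.elim (algebraMap (MvPolynomial (Option σ) K) _ (X none * rename some F + C c * rename some G)
      * (v⁻¹).1) (fun i => algebraMap (MvPolynomial (Option σ) K) _ (X (some i)))), fun p => ?_, ?_⟩
    · rw [aeval_rename]
      change aeval (fun i => algebraMap (MvPolynomial (Option σ) K) _ (X (some i))) p = _
      have : (aeval (fun i => algebraMap (MvPolynomial (Option σ) K) (Localization.Away h) (X (some i)))) =
        (Algebra.algHom K (MvPolynomial (Option σ) K) (Localization.Away h)).comp (rename some) := by
        ext; simp only [aeval_X, AlgHom.comp_apply, rename_X]; rfl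
      rw [this]; rfl
    · rw [aeval_X, ← hv]
      simp [mul_assoc]
  obtain ⟨φ, hφ, hφX⟩ := key g (Dvd.intro_left _ rfl) (-1)
  obtain ⟨ψ, hψ, hψX⟩ := key f (Dvd.intro_left _ rfl) 1
  have hφf : φ f = algebraMap (MvPolynomial (Option σ) K) _ (g * rename some F) := by
    simp only [f, g, map_mul, map_add, hφ, hφX]
    simp
  have hψg : ψ g = algebraMap (MvPolynomial (Option σ) K) _ (X none * rename some F + rename some G) := by
    simp only [g, map_mul, hψ, hψX]
    simp
  have ug := IsLocalization.Away.algebraMap_isUnit (S := Localization.Away g) g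
  have uF : IsUnit (algebraMap (MvPolynomial (Option σ) K) (Localization.Away g) (rename some F)) :=
    IsLocalization.Away.isUnit_of_dvd g (Dvd.intro_left _ rfl)
  have uf := IsLocalization.Away.algebraMap_isUnit (S := Localization.Away f) f
  have uF' : IsUnit (algebraMap (MvPolynomial (Option σ) K) (Localization.Away f) (rename some F)) :=
    IsLocalization.Away.isUnit_of_dvd f (Dvd.intro_left _ rfl)
  have uφ : IsUnit (φ f) := by rw [hφf, map_mul]; exact ug.mul uF
  have uψ : IsUnit (ψ g) := by
    rw [hψg]; exact IsLocalization.Away.isUnit_of_dvd f (Dvd.intro _ rfl)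
  refine complClass_congr_of_away φ ψ uφ uψ (fun Φ hΦ i => ?_) (fun Ψ hΨ i => ?_)
  · rcases i with _ | i
    · refine uF.mul_right_cancel ?_
      have h1 := congrArg Φ hψX
      rw [map_mul, hΦ, hΦ, hφ, map_add, map_mul, map_mul, hφ, hφX, hφ] at h1
      simpa using h1
    · have h1 := hφ (X i)
      have h2 := hψ (X i)
      rw [rename_X] at h1 h2
      rw [h2, hΦ, h1]
  · rcases i with _ | i
    · refine uF'.mul_right_cancel ?_
      have h1 := congrArg Ψ hφX
      rw [map_mul, hΨ, hΨ, hψ, map_add, map_mul, map_mul, hψ, hψX, hψ] at h1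
      simpa using h1
    · have h1 := hφ (X i)
      have h2 := hψ (X i)
      rw [rename_X] at h1 h2
      rw [h1, hΨ, h2]

end ComplClass

/-! ### Cut-and-paste rules for points, lines, products and linear polynomials. -/

section Calculus

open MvPolynomial

variable {K : Type u} [Field K] {σ τ : Type} [Finite σ] [Finite τ]

theorem complClass_X_unit : complClass (X () : MvPolynomial Unit K) = torusClass K := rfl

theorem complClass_one : complClass (1 : MvPolynomial σ K) = affineClass K (MvPolynomial σ K) := by
  rw [complClass_eq_affineClass]
  exact affineClass_congr ((IsLocalization.atOne (MvPolynomial σ K)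
    (Localization.Away (1 : MvPolynomial σ K))).restrictScalars K).symm

theorem complClass_one_of_isEmpty [IsEmpty σ] : complClass (1 : MvPolynomial σ K) = 1 := by
  rw [complClass_one, affineClass_congr (isEmptyAlgEquiv K σ), affineClass_self]

theorem complClass_one_unit : complClass (1 : MvPolynomial Unit K) = torusClass K + 1 := by
  have h := complClass_sub_eq_affineClass (1 : MvPolynomial Unit K) (X ())
  rw [one_mul, complClass_X_unit, sub_eq_iff_eq_add'] at h
  rw [h, map_one]
  congr 1
  let I : Ideal (MvPolynomial Unit K) := Ideal.span {X ()}
  have hI : ∀ a ∈ I, (aeval 0 : MvPolynomial Unit K →ₐ[K] K) a = 0 := fun a ha => by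
    obtain ⟨b, rfl⟩ := Ideal.mem_span_singleton.mp ha
    simp
  have e : (MvPolynomial Unit K ⧸ I) ≃ₐ[K] K := by
    refine AlgEquiv.ofAlgHom (Ideal.Quotient.liftₐ I (aeval 0) hI) (Algebra.ofId K _) ?_ ?_
    · ext
    · refine Ideal.Quotient.algHom_ext _ (MvPolynomial.algHom_ext fun i => ?_)
      have h0 : Ideal.Quotient.mk I (X i) = 0 :=
        Ideal.Quotient.eq_zero_iff_mem.mpr (Ideal.mem_span_singleton_self _)
      change Algebra.ofId K _ (Ideal.Quotient.liftₐ I (aeval 0) hI (Ideal.Quotient.mk I (X i))) =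
        Ideal.Quotient.mk I (X i)
      rw [h0, map_zero, map_zero]
  rw [← affineClass_self (K := K), ← affineClass_congr e]
  exact affineClass_congr ((IsLocalization.atOne (MvPolynomial Unit K ⧸ I)
    (Localization.Away (1 : MvPolynomial Unit K ⧸ I))).restrictScalars K).symm

theorem complClass_option (F : MvPolynomial σ K) (g : MvPolynomial Unit K) :
    complClass (rename some F * rename (fun _ => none) g : MvPolynomial (Option σ) K) =
      complClass g * complClass F := by
  rw [← complClass_rename (Equiv.optionEquivSumPUnit σ), mul_comm (complClass g),
    ← complClass_rename_mul_rename, map_mul, rename_rename, rename_rename]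
  rfl

theorem complClass_rename_some (F : MvPolynomial σ K) :
    complClass (rename some F) = (torusClass K + 1) * complClass F := by
  have h := complClass_option F (1 : MvPolynomial Unit K)
  rwa [map_one, mul_one, complClass_one_unit] at h

theorem complClass_X_none_mul (F : MvPolynomial σ K) :
    complClass (X none * rename some F) = torusClass K * complClass F := by
  have h := complClass_option F (X () : MvPolynomial Unit K)
  rwa [rename_X, mul_comm, complClass_X_unit] at h

/-- The class of the complement of the zero locus of a polynomial that is linear in one
of the variables. -/
theorem complClass_linear (F G : MvPolynomial σ K) :
    complClass (rename some G + rename some F * X none) =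
      torusClass K * complClass F +
        (torusClass K + 1) * (complClass G - complClass (G * F)) := by
  -- Where `F = 0` the polynomial restricts to `G` and the new coordinate is free. Where `F ≠ 0` the
  -- change of coordinate of `complClass_linear_mul` leaves a torus factor.
  have h := complClass_sub_congr (f := X none * rename some F + rename some G)
    (f' := rename some G) (g := rename some F) (by simp)
  rw [complClass_linear_mul, ← map_mul, complClass_X_none_mul, complClass_rename_some,
    complClass_rename_some, sub_eq_iff_eq_add] at h
  rw [add_comm, mul_comm, h]
  ring

end Calculus

/-! ### Two-terminal networks -/

section Network

variable {R S : Type*} [CommRing R] [CommRing S]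

/-- A two-terminal network is described by the pair of its Kirchhoff polynomial with the
terminals identified and its Kirchhoff polynomial. This is the effect on it of an additional edge
in series. -/
def serialEdge (p : R × R) (x : R) : R × R := (p.1 + p.2 * x, p.2)

/-- The effect on a two-terminal network of an additional edge in parallel. -/
def parallelEdge (p : R × R) (x : R) : R × R := (p.1 * x, p.1 + p.2 * x)

theorem map_serialEdge (φ : R →+* S) (p : R × R) (x : R) :
    Prod.map φ φ (serialEdge p x) = serialEdge (Prod.map φ φ p) (φ x) := by
  simp [serialEdge]

theorem map_parallelEdge (φ : R →+* S) (p : R × R) (x : R) :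
    Prod.map φ φ (parallelEdge p x) = parallelEdge (Prod.map φ φ p) (φ x) := by
  simp [parallelEdge]

/-- The variables of the string of `n` nested `(1,3,1)`-bananifications of an edge. -/
def StringVar : ℕ → Type
  | 0 => Unit
  | n + 1 => Option (Option (Option (Option (StringVar n))))

instance : ∀ n, Finite (StringVar n)
  | 0 => inferInstanceAs (Finite Unit)
  | n + 1 =>
    have := instFiniteStringVar n
    inferInstanceAs (Finite (Option (Option (Option (Option (StringVar n))))))

/-- The two-terminal network that results from `n` nested `(1,3,1)`-bananifications of an edge. -/
def stringNet : ∀ n, (StringVar n → R) → R × R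
  | 0, w => (w (), 1)
  | n + 1, w => serialEdge (serialEdge (parallelEdge (parallelEdge
      (stringNet n fun i => w (some (some (some (some i))))) (w (some (some (some none)))))
      (w (some (some none)))) (w (some none))) (w none)

theorem map_stringNet (φ : R →+* S) : ∀ (n : ℕ) (w : StringVar n → R),
    Prod.map φ φ (stringNet n w) = stringNet n (φ ∘ w)
  | 0, w => by simp [stringNet, Function.comp_def]
  | n + 1, w => by
    simp only [stringNet, map_serialEdge, map_parallelEdge, map_stringNet φ n]
    rfl

end Network

/-! ### Classes attached to two-terminal networks. -/

section NetworkClass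

open MvPolynomial

variable {K : Type u} [Field K] {σ τ : Type} [Finite σ] [Finite τ]

/-- The embedding of polynomials in the variables `σ` into those in one more variable. -/
noncomputable abbrev liftPair (p : MvPolynomial σ K × MvPolynomial σ K) :
    MvPolynomial (Option σ) K × MvPolynomial (Option σ) K :=
  Prod.map (rename some) (rename some) p

/-- The triple of classes attached to a pair of polynomials `(a, b)`: the loci `a ≠ 0`, `b ≠ 0`
and `a b ≠ 0`. -/
structure HasClasses (p : MvPolynomial σ K × MvPolynomial σ K) (α β π : K0 K) : Prop where
  fst : complClass p.1 = α
  snd : complClass p.2 = β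
  mul : complClass (p.1 * p.2) = π

theorem HasClasses.serialEdge {p : MvPolynomial σ K × MvPolynomial σ K} {α β π : K0 K}
    (h : HasClasses p α β π) : HasClasses (serialEdge (liftPair p) (X none))
      (torusClass K * β + (torusClass K + 1) * (α - π)) ((torusClass K + 1) * β)
      (torusClass K * β) where
  fst := by
    change complClass (rename some p.1 + rename some p.2 * X none) = _
    rw [complClass_linear, h.fst, h.snd, h.mul]
  snd := by
    change complClass (rename some p.2) = _
    rw [complClass_rename_some, h.snd]
  mul := by
    change complClass ((rename some p.1 + rename some p.2 * X none) * rename some p.2) = _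
    rw [add_comm, mul_comm _ (X none), complClass_linear_mul, complClass_X_none_mul, h.snd]

theorem HasClasses.parallelEdge {p : MvPolynomial σ K × MvPolynomial σ K} {α β π : K0 K}
    (h : HasClasses p α β π) : HasClasses (parallelEdge (liftPair p) (X none))
      (torusClass K * α) (torusClass K * β + (torusClass K + 1) * (α - π))
      (torusClass K * α - π) where
  fst := by
    change complClass (rename some p.1 * X none) = _
    rw [mul_comm, complClass_X_none_mul, h.fst]
  snd := by
    change complClass (rename some p.1 + rename some p.2 * X none) = _
    rw [complClass_linear, h.fst, h.snd, h.mul]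
  mul := by
    change complClass ((rename some p.1 * X none) * (rename some p.1 + rename some p.2 * X none))
      = _
    -- The polynomial `a x (a + b x)` is `x` times `a² + a b x`, which is linear in `x`. Its class
    -- is that of `a² + a b x ≠ 0` minus the part on `x = 0`, where only `a² ≠ 0` remains.
    have h1 := complClass_sub_congr
      (f := rename some (p.1 * p.1) + rename some (p.1 * p.2) * X none)
      (f' := rename some (p.1 * p.1)) (g := X none) (by simp)
    have h2 : complClass (p.1 * p.1) = α := by
      rw [← mul_one (p.1 * p.1), complClass_sq_mul, mul_one, h.fst]
    have h3 : complClass (p.1 * p.1 * (p.1 * p.2)) = π := by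
      rw [complClass_sq_mul, ← mul_assoc, complClass_sq_mul, h.mul]
    rw [complClass_linear, mul_comm (rename some (p.1 * p.1)) (X none), complClass_X_none_mul,
      complClass_rename_some, h2, h3, h.mul] at h1
    have h4 : (rename some p.1 * X none) * (rename some p.1 + rename some p.2 * X none) =
        (rename some (p.1 * p.1) + rename some (p.1 * p.2) * X none) * X none := by
      rw [map_mul, map_mul]; ring
    rw [h4]
    linear_combination -h1

variable (K) in
/-- The generic two-terminal network given by a string of nested bananifications. -/
noncomputable abbrev genericString (n : ℕ) :
    MvPolynomial (StringVar n) K × MvPolynomial (StringVar n) K := stringNet n X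

variable (K) in
/-- A generic string with two parallel edges. -/
noncomputable def genericCircle (n : ℕ) : MvPolynomial (Option (Option (StringVar n))) K ×
    MvPolynomial (Option (Option (StringVar n))) K :=
  parallelEdge (liftPair (parallelEdge (liftPair (genericString K n)) (X none))) (X none)

theorem liftPair_serialEdge {σ : Type} (p : MvPolynomial σ K × MvPolynomial σ K) (x : MvPolynomial σ K) :
    liftPair (serialEdge p x) = serialEdge (liftPair p) (rename some x) :=
  map_serialEdge (rename some).toRingHom p x

theorem liftPair_parallelEdge {σ : Type} (p : MvPolynomial σ K × MvPolynomial σ K) (x : MvPolynomial σ K) :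
    liftPair (parallelEdge p x) = parallelEdge (liftPair p) (rename some x) :=
  map_parallelEdge (rename some).toRingHom p x

theorem liftPair_stringNet {σ : Type} (n : ℕ) (w : StringVar n → MvPolynomial σ K) :
    liftPair (stringNet n w) = stringNet n fun i => rename some (w i) :=
  map_stringNet (rename some).toRingHom n w

theorem genericString_succ (n : ℕ) : genericString K (n + 1) =
    serialEdge (liftPair (serialEdge (liftPair (genericCircle K n)) (X none))) (X none) := by
  simp only [genericCircle, liftPair_serialEdge, liftPair_parallelEdge, liftPair_stringNet,
    rename_X]
  rfl

open Polynomial in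
/-- Together with `chainG`, the numerical invariants of the chains of circles. -/
noncomputable def chainBG : ℕ → ℤ[X] × ℤ[X]
  | 0 => (1, 0)
  | n + 1 => ((Polynomial.X + 1) * (chainBG n).1 + (chainBG n).2,
      (Polynomial.X - 1) * (chainBG n).1 + (chainBG n).2)

theorem chainBG_succ (n : ℕ) : chainBG (n + 1) =
    ((Polynomial.X + 1) * (chainBG n).1 + (chainBG n).2,
      (Polynomial.X - 1) * (chainBG n).1 + (chainBG n).2) := rfl

/-- After a serial edge the triple depends on `β` and `α - π` only, so no closed form of `α` or `π`
is needed. Two serial edges multiply both quantities by `(𝕋 + 1)²` and make `π` a multiple of `β`;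
two parallel edges then mix them by the recursion of `chainBG`, with a further factor `𝕋`. -/
theorem genericCircle_hasClasses (n : ℕ) : ∃ α π : K0 K,
    HasClasses (genericCircle K n) α (torusClass K ^ (n + 1) * (torusClass K + 1) ^ (2 * n + 1) *
      Polynomial.aeval (torusClass K) (chainBG (n + 1)).1) π ∧
    α - π = torusClass K ^ (n + 1) * (torusClass K + 1) ^ (2 * n) *
      Polynomial.aeval (torusClass K) (chainBG (n + 1)).2 := by
  induction n with
  | zero =>
    -- A bare edge has `b = 1`, hence `α = π`: this is the zero in `chainBG 0`.
    have h : HasClasses (genericString K 0) (torusClass K) (torusClass K + 1) (torusClass K) := by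
      refine ⟨rfl, complClass_one_unit, ?_⟩
      change complClass ((X () : MvPolynomial Unit K) * (1 : MvPolynomial Unit K)) = _
      rw [mul_one, complClass_X_unit]
    refine ⟨_, _, ⟨h.parallelEdge.parallelEdge.fst, ?_, h.parallelEdge.parallelEdge.mul⟩, ?_⟩
    · refine h.parallelEdge.parallelEdge.snd.trans ?_
      simp [chainBG]; ring
    · simp [chainBG]; ring
  | succ n ih =>
    obtain ⟨α, π, h, hδ⟩ := ih
    have h' := h.serialEdge.serialEdge
    rw [← genericString_succ] at h'
    have h2 := h'.parallelEdge.parallelEdge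
    have hα : α = π + torusClass K ^ (n + 1) * (torusClass K + 1) ^ (2 * n) *
      Polynomial.aeval (torusClass K) (chainBG (n + 1)).2 := by rw [← hδ]; ring
    subst hα
    refine ⟨_, _, ⟨h2.fst, ?_, h2.mul⟩, ?_⟩
    · refine h2.snd.trans ?_
      rw [chainBG_succ (n + 1)]
      simp only [map_add, map_mul, map_one, Polynomial.aeval_X]
      ring
    · rw [chainBG_succ (n + 1)]
      simp only [map_add, map_mul, map_sub, map_one, Polynomial.aeval_X]
      ring

theorem complClass_genericString_snd (n : ℕ) : complClass (genericString K (n + 1)).2 =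
    torusClass K ^ (n + 1) * (torusClass K + 1) ^ (2 * n + 3) *
      Polynomial.aeval (torusClass K) (chainBG (n + 1)).1 := by
  obtain ⟨α, π, h, -⟩ := genericCircle_hasClasses (K := K) n
  have h' := h.serialEdge.serialEdge
  rw [← genericString_succ] at h'
  exact h'.snd.trans (by ring)

/-- Needed for `GammaVac`: two of the three unmarked edges of the `4`-banana belong to
`genericCircle`, and the third is the parallel edge added here. -/
theorem complClass_parallelEdge_genericCircle_snd (n : ℕ) :
    complClass (parallelEdge (liftPair (genericCircle K n)) (X none)).2 =
      torusClass K ^ (n + 1) * (torusClass K + 1) ^ (2 * n + 1) *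
        Polynomial.aeval (torusClass K)
          (Polynomial.X * (chainBG (n + 1)).1 + (chainBG (n + 1)).2) := by
  obtain ⟨α, π, h, hδ⟩ := genericCircle_hasClasses (K := K) n
  rw [h.parallelEdge.snd, hδ]
  simp only [map_add, map_mul, Polynomial.aeval_X]
  ring

/-! ### Closed chains of networks -/

/-- The Kirchhoff polynomial of a closed chain of two-terminal networks. -/
def closedChain {R : Type*} [CommRing R] {s : ℕ} (w : Fin s → R × R) : R :=
  ∑ i, ∏ j, if j = i then (w j).1 else (w j).2

theorem closedChain_succ {R : Type*} [CommRing R] {s : ℕ} (w : Fin (s + 1) → R × R) :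
    closedChain w = (w 0).1 * ∏ j : Fin s, (w j.succ).2 +
      (w 0).2 * closedChain fun j : Fin s => w j.succ := by
  have h (j : Fin s) : (0 : Fin (s + 1)) ≠ j.succ := (Fin.succ_ne_zero j).symm
  simp [closedChain, Fin.sum_univ_succ, Fin.prod_univ_succ, Finset.mul_sum, h]

/-- The difference is the part of `x ≠ 0` where `b F = 0`. It splits into `b = 0`, where `x`
restricts to `a F`, and `b ≠ 0`, `F = 0`, where `x` restricts to `b G`. -/
theorem complClass_chain_sub {a b : MvPolynomial σ K} {F G : MvPolynomial τ K} {α β π : K0 K}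
    (h : HasClasses (a, b) α β π) {x : MvPolynomial (σ ⊕ τ) K}
    (hx : x = rename Sum.inl a * rename Sum.inr F + rename Sum.inl b * rename Sum.inr G) :
    complClass x - complClass (x * (rename Sum.inl b * rename Sum.inr F)) =
      (α - π) * complClass F + β * (complClass G - complClass (G * F)) := by
  have h1 := complClass_sub_congr (f := x) (f' := rename Sum.inl a * rename Sum.inr F)
    (g := rename Sum.inl b) (by simp [hx])
  have h2 := complClass_sub_congr (f := x * rename Sum.inl b)
    (f' := rename Sum.inl (b * b) * rename Sum.inr G) (g := rename Sum.inr F)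
    ⟨rename Sum.inl (a * b), by simp only [hx, map_mul]; ring⟩
  have h3 : complClass (b * b) = β := by
    rw [← mul_one (b * b), complClass_sq_mul, mul_one]; exact h.snd
  rw [complClass_rename_mul_rename, mul_right_comm, ← map_mul, complClass_rename_mul_rename,
    show complClass a = α from h.fst, show complClass (a * b) = π from h.mul] at h1
  rw [complClass_rename_mul_rename, mul_assoc _ (rename Sum.inr G), ← map_mul (rename Sum.inr),
    complClass_rename_mul_rename, h3] at h2
  rw [← mul_assoc]
  linear_combination h1 + h2

/-- One more variable on the left of a disjoint union. -/
def optionSumEquiv (σ τ : Type) : Option σ ⊕ τ ≃ Option (σ ⊕ τ) where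
  toFun := Sum.elim (fun i => i.map Sum.inl) (fun j => some (Sum.inr j))
  invFun i := i.elim (Sum.inl none) (Sum.map some id)
  left_inv := by rintro ((_ | i) | j) <;> rfl
  right_inv := by rintro (_ | i | j) <;> rfl

/-- The closed chain is linear in the variable of the serial edge, with coefficient `b F`. Where
this coefficient is nonzero, a change of coordinate removes the rest of the polynomial. -/
theorem complClass_chain_mul (p : MvPolynomial σ K × MvPolynomial σ K) (F G : MvPolynomial τ K) :
    complClass ((rename Sum.inl (serialEdge (liftPair p) (X none)).1 * rename Sum.inr F +
      rename Sum.inl (serialEdge (liftPair p) (X none)).2 * rename Sum.inr G) *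
      (rename Sum.inl (serialEdge (liftPair p) (X none)).2 * rename Sum.inr F)) =
    torusClass K * (complClass p.2 * complClass F) := by
  rw [← complClass_rename_mul_rename, ← complClass_X_none_mul, ← complClass_linear_mul _
    (rename Sum.inl p.1 * rename Sum.inr F + rename Sum.inl p.2 * rename Sum.inr G),
    ← complClass_rename (optionSumEquiv σ τ)]
  congr 1
  have h1 (f : MvPolynomial σ K) : rename (optionSumEquiv σ τ) (rename Sum.inl (rename some f)) =
      rename some (rename Sum.inl f) := by simp only [rename_rename]; rfl
  have h2 (f : MvPolynomial τ K) : rename (optionSumEquiv σ τ) (rename Sum.inr f) =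
      rename some (rename Sum.inr f) := by simp only [rename_rename]; rfl
  have h3 : rename (optionSumEquiv σ τ) (rename Sum.inl (X none)) =
      (X none : MvPolynomial (Option (σ ⊕ τ)) K) := by simp only [rename_X]; rfl
  simp only [serialEdge, liftPair, Prod.map_fst, Prod.map_snd, map_add, map_mul, h1, h2, h3]
  ring

/-- The pair of polynomials `p` in the `i`-th copy of its variables. -/
noncomputable def copyPair {s : ℕ} (p : MvPolynomial σ K × MvPolynomial σ K) (i : Fin s) :
    MvPolynomial (Fin s × σ) K × MvPolynomial (Fin s × σ) K :=
  Prod.map (rename (Prod.mk i)) (rename (Prod.mk i)) p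

/-- Splitting off the first of `s + 1` copies. -/
def finSuccProdEquiv (s : ℕ) (σ : Type) : Fin (s + 1) × σ ≃ σ ⊕ Fin s × σ where
  toFun x := Fin.cases (Sum.inl x.2) (fun i => Sum.inr (i, x.2)) x.1
  invFun := Sum.elim (Prod.mk 0) (fun x => (x.1.succ, x.2))
  left_inv := by
    rintro ⟨i, x⟩
    induction i using Fin.cases <;> rfl
  right_inv := by rintro (x | ⟨i, x⟩) <;> rfl

theorem rename_copyPair_zero {σ : Type} (s : ℕ) (f : MvPolynomial σ K) :
    rename (finSuccProdEquiv s σ) (rename (Prod.mk 0) f) = rename Sum.inl f := by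
  rw [rename_rename]; rfl

theorem rename_copyPair_succ {σ : Type} {s : ℕ} (i : Fin s) (f : MvPolynomial σ K) :
    rename (finSuccProdEquiv s σ) (rename (Prod.mk i.succ) f) =
      rename Sum.inr (rename (Prod.mk i) f) := by
  rw [rename_rename, rename_rename]; rfl

theorem rename_prod_copyPair {σ : Type} (p : MvPolynomial σ K × MvPolynomial σ K) (s : ℕ) :
    rename (finSuccProdEquiv s σ) (∏ i, (copyPair p i).2) =
      rename Sum.inl p.2 * rename Sum.inr (∏ i : Fin s, (copyPair p i).2) := by
  rw [Fin.prod_univ_succ, map_mul, map_prod, map_prod]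
  simp only [copyPair, Prod.map, rename_copyPair_succ, rename_copyPair_zero]

theorem rename_closedChain_copyPair {σ : Type} (p : MvPolynomial σ K × MvPolynomial σ K) (s : ℕ) :
    rename (finSuccProdEquiv s σ) (closedChain (copyPair p)) =
      rename Sum.inl p.1 * rename Sum.inr (∏ i : Fin s, (copyPair p i).2) +
      rename Sum.inl p.2 * rename Sum.inr (closedChain (copyPair (s := s) p)) := by
  rw [closedChain_succ]
  simp only [closedChain, map_mul, map_add, map_prod, map_sum, copyPair, Prod.map,
    rename_copyPair_succ, rename_copyPair_zero, apply_ite (rename (finSuccProdEquiv s σ)),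
    apply_ite (rename (R := K) (Sum.inr : Fin s × σ → σ ⊕ Fin s × σ))]

theorem complClass_prod_copyPair (p : MvPolynomial σ K × MvPolynomial σ K) (s : ℕ) :
    complClass (∏ i : Fin s, (copyPair p i).2) = complClass p.2 ^ s := by
  induction s with
  | zero => rw [Fin.prod_univ_zero, complClass_one_of_isEmpty, pow_zero]
  | succ s ih =>
    rw [← complClass_rename (finSuccProdEquiv s σ), rename_prod_copyPair,
      complClass_rename_mul_rename, ih, pow_succ']

/-- If the closed chain is nonzero and some `b_j` vanishes, then it is the only one to vanish, and
`a_j ≠ 0`. Each of the `s` choices of `j` contributes `(α - π) β^(s-1)`. For `s = 0` the truncated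
exponent is harmless, as the factor `s` is zero. -/
theorem complClass_closedChain_sub {p : MvPolynomial σ K × MvPolynomial σ K} {α β π : K0 K}
    (h : HasClasses p α β π) (s : ℕ) :
    complClass (closedChain (copyPair (s := s) p)) -
      complClass (closedChain (copyPair (s := s) p) * ∏ i : Fin s, (copyPair p i).2) =
    s * β ^ (s - 1) * (α - π) := by
  induction s with
  | zero => simp
  | succ s ih =>
    rw [← complClass_rename (finSuccProdEquiv s σ), ← complClass_rename (finSuccProdEquiv s σ)
      (closedChain _ * _), map_mul, rename_prod_copyPair, complClass_chain_sub (a := p.1) (b := p.2)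
      h (rename_closedChain_copyPair p s), ih, complClass_prod_copyPair, h.snd]
    cases s with
    | zero => simp
    | succ s => simp only [Nat.add_sub_cancel]; push_cast; ring

/-- The locus where no `b_j` vanishes gives the term in `𝕋 β`; there a single serial edge is used
for the change of coordinate. The locus where one `b_j` vanishes gives the term in `α - π`. -/
theorem complClass_closedChain {p : MvPolynomial σ K × MvPolynomial σ K} {α β π : K0 K}
    (h : HasClasses p α β π) (s : ℕ) :
    complClass (closedChain (copyPair (s := s + 1) (serialEdge (liftPair p) (X none)))) =
      ((torusClass K + 1) * β) ^ s *
        (torusClass K * β + (s + 1) * (torusClass K + 1) * (α - π)) := by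
  have h1 := complClass_closedChain_sub h.serialEdge (s + 1)
  have h2 : complClass (closedChain (copyPair (s := s + 1) (serialEdge (liftPair p) (X none))) *
      ∏ i, (copyPair (s := s + 1) (serialEdge (liftPair p) (X none)) i).2) =
      torusClass K * (β * ((torusClass K + 1) * β) ^ s) := by
    rw [← complClass_rename (finSuccProdEquiv s _), map_mul, rename_prod_copyPair,
      rename_closedChain_copyPair, complClass_chain_mul, complClass_prod_copyPair, h.snd,
      h.serialEdge.snd]
  rw [h2, sub_eq_iff_eq_add] at h1
  rw [h1]
  simp only [Nat.add_sub_cancel]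
  push_cast
  ring

end NetworkClass

/-! ### Spanning trees of multigraphs -/

namespace Multigraph

variable (G : Multigraph)

/-- Connectedness is tested by functions constant along the edges; the indicator function of a
component suffices. With values in a field, linear algebra applies. -/
theorem joined_iff (S : Set G.E) (u v : G.V) : G.Joined S u v ↔
    ∀ f : G.V → ZMod 2, (∀ e ∈ S, f (G.src e) = f (G.tgt e)) → f u = f v := by
  classical
  constructor
  · intro h f hf
    induction h with
    | rel u v h => obtain ⟨e, he, rfl, rfl⟩ := h; exact hf e he
    | refl => rfl
    | symm _ _ _ ih => exact ih.symm
    | trans _ _ _ _ _ ih₁ ih₂ => exact ih₁.trans ih₂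
  · intro h
    have h1 := h (fun w => if G.Joined S u w then 1 else 0) fun e he => by
      have h2 : G.Joined S (G.src e) (G.tgt e) := .rel _ _ ⟨e, he, rfl, rfl⟩
      have : G.Joined S u (G.src e) ↔ G.Joined S u (G.tgt e) :=
        ⟨fun h => h.trans _ _ _ h2, fun h => h.trans _ _ _ (h2.symm _ _)⟩
      simp only [this]
    by_contra hn
    simp [hn, show G.Joined S u u from .refl u] at h1

/-- The coboundary of a function on the vertices, restricted to a set of edges. -/
def coboundary (S : Set G.E) : (G.V → ZMod 2) →ₗ[ZMod 2] (S → ZMod 2) where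
  toFun f e := f (G.src e) - f (G.tgt e)
  map_add' f g := by ext e; simp only [Pi.add_apply]; ring
  map_smul' c f := by ext e; simp only [Pi.smul_apply, smul_eq_mul, RingHom.id_apply]; ring

/-- Surjectivity means that the functionals `f (src e) - f (tgt e)`, `e ∈ S`, are linearly
independent. Acyclicity thereby becomes a statement about rank. -/
theorem coboundary_surjective_iff (S : Set G.E) : Function.Surjective (G.coboundary S) ↔
    ∀ e ∈ S, ¬ G.Joined (S \ {e}) (G.src e) (G.tgt e) := by
  classical
  constructor
  · intro h e he hj
    obtain ⟨f, hf⟩ := h (Pi.single ⟨e, he⟩ 1)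
    rw [joined_iff] at hj
    have h1 := congrFun hf ⟨e, he⟩
    rw [Pi.single_eq_same] at h1
    refine one_ne_zero (h1.symm.trans (sub_eq_zero.mpr (hj f fun e' he' => ?_)))
    have h2 := congrFun hf ⟨e', he'.1⟩
    rw [Pi.single_eq_of_ne (fun h : (⟨e', he'.1⟩ : S) = ⟨e, he⟩ => he'.2 (congrArg Subtype.val h))] at h2
    exact sub_eq_zero.mp h2
  · intro h
    have := Fintype.ofFinite S
    rw [← LinearMap.range_eq_top, eq_top_iff]
    intro y _
    rw [← Finset.univ_sum_single y]
    refine Submodule.sum_mem _ fun e _ => ?_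
    have h1 := h e e.2
    rw [joined_iff] at h1
    push Not at h1
    obtain ⟨f, hf, hne⟩ := h1
    have h2 : f (G.src e) - f (G.tgt e) ≠ 0 := sub_ne_zero.mpr hne
    refine ⟨(y e * (f (G.src e) - f (G.tgt e))⁻¹) • f, funext fun e' => ?_⟩
    rw [map_smul, Pi.smul_apply, smul_eq_mul]
    change _ * (f (G.src e') - f (G.tgt e')) = _
    by_cases he : e' = e
    · subst he
      rw [Pi.single_eq_same, mul_assoc, inv_mul_cancel₀ h2, mul_one]
    · rw [Pi.single_eq_of_ne he, hf e' ⟨e'.2, fun h => he (Subtype.ext h)⟩, sub_self, mul_zero]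

theorem finrank_ker_coboundary [Nonempty G.V] {S : Set G.E} (h : ∀ u v, G.Joined S u v) :
    Module.finrank (ZMod 2) (LinearMap.ker (G.coboundary S)) = 1 := by
  rw [finrank_eq_one_iff']
  refine ⟨⟨fun _ => 1, ?_⟩, ?_, fun ⟨f, hf⟩ => ?_⟩
  · ext e; exact sub_self _
  · intro h
    exact one_ne_zero (congrFun (congrArg Subtype.val h) (Classical.arbitrary G.V))
  · refine ⟨f (Classical.arbitrary G.V), Subtype.ext (funext fun v => ?_)⟩
    change f _ * 1 = f v
    rw [mul_one]
    exact (G.joined_iff S _ _).mp (h _ _) f fun e he =>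
      sub_eq_zero.mp (congrFun (LinearMap.mem_ker.mp hf) ⟨e, he⟩)

/-- Spanning trees are the connected sets of edges with the right number of elements. -/
theorem isSpanningTree_iff [Nonempty G.V] (S : Set G.E) : G.IsSpanningTree S ↔
    (∀ u v, G.Joined S u v) ∧ Nat.card S + 1 = Nat.card G.V := by
  refine and_congr_right fun h => ?_
  have := Fintype.ofFinite S
  have := Fintype.ofFinite G.V
  -- For connected `S` the kernel consists of the constants, so by rank-nullity the rank is `|V| -
  -- 1`, and surjectivity is a matter of counting.
  rw [← coboundary_surjective_iff, ← LinearMap.range_eq_top]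
  have h1 := (G.coboundary S).finrank_range_add_finrank_ker
  rw [G.finrank_ker_coboundary h, Module.finrank_fintype_fun_eq_card] at h1
  rw [Nat.card_eq_fintype_card, Nat.card_eq_fintype_card, ← h1,
    ← Module.finrank_fintype_fun_eq_card (ZMod 2), add_left_inj]
  exact ⟨fun h => by rw [h, finrank_top], fun h => Submodule.eq_top_of_finrank_eq h.symm⟩

variable {G} in
theorem IsSpanningTree.not_parallel {S : Set G.E} (h : G.IsSpanningTree S) {e e' : G.E}
    (he : e ∈ S) (he' : e' ∈ S) (hne : e' ≠ e) (h₁ : G.src e' = G.src e)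
    (h₂ : G.tgt e' = G.tgt e) : False :=
  h.2 e he (.rel _ _ ⟨e', ⟨he', hne⟩, h₁, h₂⟩)

theorem card_setOf_eq_sum {E F : Type} [Fintype F] (φ : E ≃ F) (x : F → Bool) :
    Nat.card {e | x (φ e) = true} = ∑ f, (x f).toNat := by
  have e : {e | x (φ e) = true} ≃ {f // x f = true} := φ.subtypeEquiv fun _ => Iff.rfl
  rw [Nat.card_congr e, Nat.card_eq_fintype_card, Fintype.card_subtype, Finset.card_filter]
  exact Finset.sum_congr rfl fun f _ => by cases x f <;> rfl

section TreePoly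

variable {R : Type*} [CommRing R]

open Classical in
/-- The homogeneous form of the Kirchhoff polynomial: the edges outside of a spanning tree
contribute a factor `a e`, and those in it a factor `b e`. -/
noncomputable def treePoly (a b : G.E → R) : R :=
  letI : Fintype G.E := Fintype.ofFinite G.E
  ∑ x : G.E → Bool, if G.IsSpanningTree {e | x e = true} then
    ∏ e, (if x e then b e else a e) else 0

open Classical in
theorem treePoly_eq {F : Type} [Fintype F] [DecidableEq F] (φ : G.E ≃ F) (a b : F → R) :
    G.treePoly (a ∘ φ) (b ∘ φ) = ∑ x : F → Bool, if G.IsSpanningTree {e | x (φ e) = true} then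
      ∏ f, (if x f then b f else a f) else 0 := by
  let _ : Fintype G.E := Fintype.ofFinite G.E
  rw [treePoly]
  refine Fintype.sum_equiv (φ.arrowCongr (Equiv.refl Bool)) _ _ fun x => ?_
  simp only [Equiv.arrowCongr_apply, Equiv.coe_refl, Function.comp_apply,
    Equiv.symm_apply_apply]
  congr 1
  exact Fintype.prod_equiv φ _ _ fun e => by simp

theorem map_treePoly {S : Type*} [CommRing S] (ψ : R →+* S) (a b : G.E → R) :
    ψ (G.treePoly a b) = G.treePoly (ψ ∘ a) (ψ ∘ b) := by
  simp only [treePoly, map_sum, apply_ite ψ, map_prod, map_zero, Function.comp_apply]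

theorem kirchhoff_eq_treePoly (K : Type*) [Field K] :
    G.kirchhoff K = G.treePoly MvPolynomial.X 1 := by
  classical
  let _ : Fintype G.E := Fintype.ofFinite G.E
  rw [kirchhoff, treePoly, Finset.sum_filter]
  refine Fintype.sum_bijective (fun (S : Finset G.E) e => decide (e ∈ S))
    ⟨fun S S' h => ?_, fun x => ⟨Finset.univ.filter (x · = true), by ext; simp⟩⟩ _ _ fun S => ?_
  · ext e
    simpa using congrFun h e
  · have h : {e | decide (e ∈ S) = true} = (S : Set G.E) := by ext; simp
    simp only [h]
    congr 1
    · rw [← Finset.prod_subset (Finset.subset_univ Sᶜ)]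
      · refine Finset.prod_congr rfl fun e he => ?_
        rw [if_neg (by simpa using he)]
      · intro e _ he
        rw [if_pos (by simpa using he)]; rfl

end TreePoly

end Multigraph

/-! ### Spanning trees under one bananification. -/

/-- A sum over local configurations, grouped by their types. -/
theorem sum_configurations {R ι P Q : Type*} [CommRing R] [Fintype ι] [Fintype P] [Fintype Q]
    [DecidableEq ι] [DecidableEq Q] (τ : P → Option Q) (T : (ι → Q) → Prop) [DecidablePred T]
    [DecidablePred fun c : ι → P => ∃ z, T z ∧ ∀ i, τ (c i) = some (z i)] (w : ι → P → R) :
    (∑ c : ι → P, if ∃ z, T z ∧ ∀ i, τ (c i) = some (z i) then ∏ i, w i (c i) else 0) =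
      ∑ z, if T z then ∏ i, ∑ p, (if τ p = some (z i) then w i p else 0) else 0 := by
  simp only [Finset.prod_univ_sum, Fintype.piFinset_univ, Finset.prod_ite_zero, Finset.mem_univ,
    true_implies]
  have h1 : ∀ z : ι → Q, (if T z then ∑ c : ι → P, (if ∀ i, τ (c i) = some (z i) then
      ∏ i, w i (c i) else 0) else 0) = ∑ c : ι → P, if T z ∧ ∀ i, τ (c i) = some (z i) then
      ∏ i, w i (c i) else 0 := by
    intro z
    by_cases hz : T z <;> simp [hz]
  simp only [h1]
  rw [Finset.sum_comm]
  refine Finset.sum_congr rfl fun c _ => ?_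
  by_cases h : ∃ z, T z ∧ ∀ i, τ (c i) = some (z i)
  · obtain ⟨z, hz⟩ := h
    rw [if_pos ⟨z, hz⟩, Finset.sum_eq_single z, if_pos hz]
    · intro z' _ hne
      refine if_neg fun hz' => hne (funext fun i => ?_)
      exact Option.some_injective _ ((hz'.2 i).symm.trans (hz.2 i))
    · simp
  · rw [if_neg h, Finset.sum_eq_zero]
    intro z _
    exact if_neg fun hz => h ⟨z, hz⟩

namespace MarkedGraph

variable {ι : Type} (G : MarkedGraph ι)

/-- The edges of a marked graph are the unmarked and the marked ones. -/
noncomputable def edgeEquiv : G.E ≃ {e : G.E // e ∉ Set.range G.mark} ⊕ ι :=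
  (Equiv.ofBijective (Sum.elim Subtype.val G.mark) (by
    constructor
    · refine Subtype.val_injective.sumElim G.mark.injective ?_
      exact fun e i h => e.2 ⟨i, h.symm⟩
    · intro e
      by_cases h : e ∈ Set.range G.mark
      · exact ⟨.inr h.choose, h.choose_spec⟩
      · exact ⟨.inl ⟨e, h⟩, rfl⟩)).symm

theorem edgeEquiv_of_not_mem {e : G.E} (h : e ∉ Set.range G.mark) :
    G.edgeEquiv e = .inl ⟨e, h⟩ := G.edgeEquiv.eq_symm_apply.mp rfl

theorem edgeEquiv_mark (i : ι) : G.edgeEquiv (G.mark i) = .inr i :=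
  G.edgeEquiv.eq_symm_apply.mp rfl

/-- The ways in which a spanning tree can meet the string that replaces a marked edge: it
either contains a spanning tree of the string (`some true`), or a spanning forest that separates
the two ends (`some false`). -/
def stringType (c : Fin 5 → Bool) : Option Bool :=
  if 1 < (c 1).toNat + (c 2).toNat + (c 3).toNat then none
  else if ∑ k, (c k).toNat = 3 then some true
  else if ∑ k, (c k).toNat = 2 then some false else none

theorem stringType_eq_true_iff : ∀ (c : Fin 5 → Bool) (z : Bool), stringType c = some z →
    (z = true ↔ c 0 = true ∧ c 4 = true ∧ (c 1 = true ∨ c 2 = true ∨ c 3 = true)) := by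
  decide

theorem stringType_attached : ∀ (c : Fin 5 → Bool) (z : Bool), stringType c = some z →
    (c 0 = true ∨ c 4 = true) ∧ (c 0 = true ∨ c 1 = true ∨ c 2 = true ∨ c 3 = true) ∧
    (c 4 = true ∨ c 1 = true ∨ c 2 = true ∨ c 3 = true) := by
  decide

theorem sum_toNat_of_stringType : ∀ (c : Fin 5 → Bool) (z : Bool), stringType c = some z →
    ∑ k, (c k).toNat = 2 + z.toNat := by
  decide

/-- The hypotheses exclude the local obstructions to a spanning tree: two parallel edges, the two
inner vertices cut off together, or one of them isolated. -/
theorem exists_stringType : ∀ c : Fin 5 → Bool, ¬ (c 1 = true ∧ c 2 = true) →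
    ¬ (c 1 = true ∧ c 3 = true) → ¬ (c 2 = true ∧ c 3 = true) →
    (c 0 = true ∨ c 4 = true) → (c 0 = true ∨ c 1 = true ∨ c 2 = true ∨ c 3 = true) →
    (c 4 = true ∨ c 1 = true ∨ c 2 = true ∨ c 3 = true) → ∃ z, stringType c = some z := by
  decide

theorem filter_stringType_true : Finset.univ.filter (stringType · = some true) =
    {![true, true, false, false, true], ![true, false, true, false, true],
      ![true, false, false, true, true]} := by
  decide

theorem filter_stringType_false : Finset.univ.filter (stringType · = some false) =
    {![true, false, false, false, true], ![true, true, false, false, false],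
      ![true, false, true, false, false], ![true, false, false, true, false],
      ![false, true, false, false, true], ![false, false, true, false, true],
      ![false, false, false, true, true]} := by
  decide

/-- A string adds two vertices, and a trace of type `z` has `2 + z` edges. The edge count of
`isSpanningTree_iff` therefore carries over, and only connectedness has to be compared. -/
theorem bananify_tree_iff [Finite ι] [Nonempty G.V]
    (x : {e : G.E // e ∉ Set.range G.mark} ⊕ ι × Fin 5 → Bool) :
    G.bananify.IsSpanningTree {e | x e = true} ↔ ∃ z : ι → Bool,
      G.IsSpanningTree {e | Sum.elim (fun e => x (.inl e)) z (G.edgeEquiv e) = true} ∧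
      ∀ i, stringType (fun k => x (.inr (i, k))) = some (z i) := by
  classical
  let _ := Fintype.ofFinite ι
  let _ := Fintype.ofFinite {e : G.E // e ∉ Set.range G.mark}
  have hV : Nonempty G.bananify.V := ⟨.inl (Classical.arbitrary G.V)⟩
  have hcard : Nat.card G.bananify.V = Nat.card G.V + 2 * Fintype.card ι := by
    change Nat.card (G.V ⊕ ι × Bool) = _
    rw [Nat.card_sum, Nat.card_prod, Nat.card_eq_fintype_card (α := ι),
      Nat.card_eq_fintype_card (α := Bool), Fintype.card_bool, mul_comm]
  have hinv (f : G.V ⊕ ι × Bool → ZMod 2) :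
      (∀ e ∈ {e | x e = true}, f (G.bananify.src e) = f (G.bananify.tgt e)) ↔
      (∀ e, x (.inl e) = true → f (.inl (G.src e.1)) = f (.inl (G.tgt e.1))) ∧
      ∀ i, (x (.inr (i, 0)) = true → f (.inl (G.src (G.mark i))) = f (.inr (i, false))) ∧
        (x (.inr (i, 1)) = true ∨ x (.inr (i, 2)) = true ∨ x (.inr (i, 3)) = true →
          f (.inr (i, false)) = f (.inr (i, true))) ∧
        (x (.inr (i, 4)) = true → f (.inr (i, true)) = f (.inl (G.tgt (G.mark i)))) := by
    constructor
    · intro h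
      refine ⟨fun e => h (.inl e), fun i => ⟨h (.inr (i, 0)), ?_, h (.inr (i, 4))⟩⟩
      rintro (h1 | h1 | h1)
      exacts [h (.inr (i, 1)) h1, h (.inr (i, 2)) h1, h (.inr (i, 3)) h1]
    · rintro ⟨h1, h2⟩ (e | ⟨i, k⟩) he
      · exact h1 e he
      · obtain ⟨h3, h4, h5⟩ := h2 i
        fin_cases k
        exacts [h3 he, h4 (.inl he), h4 (.inr (.inl he)), h4 (.inr (.inr he)), h5 he]
  have hinv' (z : ι → Bool) (f : G.V → ZMod 2) :
      (∀ e ∈ {e | Sum.elim (fun e => x (.inl e)) z (G.edgeEquiv e) = true},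
        f (G.src e) = f (G.tgt e)) ↔
      (∀ e, x (.inl e) = true → f (G.src e.1) = f (G.tgt e.1)) ∧
      ∀ i, z i = true → f (G.src (G.mark i)) = f (G.tgt (G.mark i)) := by
    rw [← G.edgeEquiv.symm.forall_congr_right, Sum.forall]
    simp only [Set.mem_ofPred_eq, Equiv.apply_symm_apply, Sum.elim_inl, Sum.elim_inr]
    rfl
  have hsum (z : ι → Bool) (hz : ∀ i, stringType (fun k => x (.inr (i, k))) = some (z i)) :
      ∑ f, (x f).toNat = ∑ f, (Sum.elim (fun e => x (.inl e)) z f).toNat +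
        2 * Fintype.card ι := by
    rw [Fintype.sum_sum_type, Fintype.sum_sum_type, Fintype.sum_prod_type, add_assoc]
    congr 1
    have h1 (i : ι) : ∑ k, (x (.inr (i, k))).toNat = 2 + (z i).toNat :=
      sum_toNat_of_stringType _ _ (hz i)
    simp only [h1, Finset.sum_add_distrib, Finset.sum_const, Finset.card_univ, smul_eq_mul,
      Sum.elim_inr]
    ring
  have hc1 := Multigraph.card_setOf_eq_sum (Equiv.refl _) x
  have hc2 (z : ι → Bool) :=
    Multigraph.card_setOf_eq_sum G.edgeEquiv (Sum.elim (fun e => x (.inl e)) z)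
  constructor
  · intro h
    have hconn (f : G.V ⊕ ι × Bool → ZMod 2) := fun hf u v =>
      (Multigraph.joined_iff _ _ u v).mp (h.1 u v) f ((hinv f).mpr hf)
    have hz : ∀ i, ∃ z, stringType (fun k => x (.inr (i, k))) = some z := by
      intro i
      have hp (k l : Fin 5) (hkl : l ≠ k)
          (h1 : G.bananify.src (.inr (i, l)) = G.bananify.src (.inr (i, k)))
          (h2 : G.bananify.tgt (.inr (i, l)) = G.bananify.tgt (.inr (i, k))) :
          ¬ (x (.inr (i, k)) = true ∧ x (.inr (i, l)) = true) := fun ⟨h3, h4⟩ =>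
        h.not_parallel (e := .inr (i, k)) (e' := .inr (i, l)) h3 h4 (fun h5 =>
          hkl (congrArg Prod.snd (Sum.inr.inj h5))) h1 h2
      -- A function supported on the inner vertices of the `i`-th string and constant along the
      -- chosen edges would disconnect the tree.
      have hcut (f : ι × Bool → ZMod 2) (b : Bool) (hf : f (i, b) = 1)
          (h0 : ∀ j ≠ i, ∀ b, f (j, b) = 0)
          (h1 : x (.inr (i, 0)) = true → f (i, false) = 0)
          (h2 : x (.inr (i, 1)) = true ∨ x (.inr (i, 2)) = true ∨ x (.inr (i, 3)) = true →
            f (i, false) = f (i, true))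
          (h3 : x (.inr (i, 4)) = true → f (i, true) = 0) : False := by
        have h4 := hconn (Sum.elim 0 f) ⟨fun _ _ => rfl, fun j => ?_⟩
          (.inl (Classical.arbitrary G.V)) (.inr (i, b))
        · exact zero_ne_one (h4.trans hf)
        · by_cases hj : j = i
          · subst hj
            exact ⟨fun h => (h1 h).symm, h2, h3⟩
          · simp [h0 j hj]
      refine exists_stringType _ (hp 1 2 (by decide) rfl rfl) (hp 1 3 (by decide) rfl rfl)
        (hp 2 3 (by decide) rfl rfl) ?_ ?_ ?_
      · by_contra hn
        push Not at hn
        exact hcut (fun p => if p.1 = i then 1 else 0) false (by simp) (fun j hj b => by simp [hj])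
          (fun h => absurd h hn.1) (fun _ => rfl) (fun h => absurd h hn.2)
      · by_contra hn
        push Not at hn
        exact hcut (fun p => if p = (i, false) then 1 else 0) false (by simp)
          (fun j hj b => by simp [hj]) (fun h => absurd h hn.1)
          (fun h => by simp [hn] at h) (fun _ => by simp)
      · by_contra hn
        push Not at hn
        exact hcut (fun p => if p = (i, true) then 1 else 0) true (by simp)
          (fun j hj b => by simp [hj]) (fun _ => by simp)
          (fun h => by simp [hn] at h) (fun h => absurd h hn.1)
    choose z hz using hz
    refine ⟨z, ?_, hz⟩
    rw [Multigraph.isSpanningTree_iff] at h ⊢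
    refine ⟨fun u v => (Multigraph.joined_iff _ _ _ _).mpr fun f hf => ?_, ?_⟩
    · rw [hinv'] at hf
      -- The extension of `f` gives an inner vertex the value at its adjacent end if the single edge
      -- between them is chosen, and the value at the other end otherwise. A conflict could only
      -- arise for type `true`, where `f` agrees at both ends.
      refine hconn (Sum.elim f fun p => bif p.2 then
        (bif x (.inr (p.1, 4)) then f (G.tgt (G.mark p.1)) else f (G.src (G.mark p.1))) else
        (bif x (.inr (p.1, 0)) then f (G.src (G.mark p.1)) else f (G.tgt (G.mark p.1))))
        ⟨hf.1, fun i => ?_⟩ (.inl u) (.inl v)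
      have h1 := stringType_eq_true_iff _ _ (hz i)
      have h3 := stringType_attached _ _ (hz i)
      have h2 := hf.2 i
      refine ⟨fun h => by simp [h], fun h => ?_, fun h => by simp [h]⟩
      simp only [Sum.elim_inr, cond_true, cond_false]
      cases h0 : x (.inr (i, 0)) <;> cases h4 : x (.inr (i, 4))
      · rw [h0, h4] at h3
        exact absurd h3.1 (by decide)
      · rfl
      · rfl
      · exact h2 (h1.mpr ⟨h0, h4, h⟩)
    · rw [hc2]
      have h3 : ∑ f, (x f).toNat + 1 = Nat.card G.V + 2 * Fintype.card ι := by
        rw [← hc1, ← hcard]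
        exact h.2
      rw [hsum z hz] at h3
      omega
  · rintro ⟨z, h, hz⟩
    rw [Multigraph.isSpanningTree_iff] at h ⊢
    refine ⟨fun u v => (Multigraph.joined_iff _ _ _ _).mpr fun f hf => ?_, ?_⟩
    · obtain ⟨h1, h2⟩ := (hinv f).mp hf
      have h3 (u v : G.V) : f (.inl u) = f (.inl v) := by
        refine (Multigraph.joined_iff _ _ u v).mp (h.1 u v) (fun v => f (.inl v))
          ((hinv' z fun v => f (.inl v)).mpr ⟨h1, fun i hi => ?_⟩)
        obtain ⟨h3, h4, h5⟩ := h2 i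
        obtain ⟨h6, h7, h8⟩ := (stringType_eq_true_iff _ _ (hz i)).mp hi
        exact ((h3 h6).trans (h4 h8)).trans (h5 h7)
      have h4 (v : G.V ⊕ ι × Bool) : f v = f (.inl (Classical.arbitrary G.V)) := by
        rcases v with v | ⟨i, b⟩
        · exact h3 v _
        · obtain ⟨h4, h5, h6⟩ := h2 i
          obtain ⟨h7, h8, h9⟩ := stringType_attached _ _ (hz i)
          have h10 : f (.inr (i, false)) = f (.inl (Classical.arbitrary G.V)) := by
            rcases h8 with h8 | h8
            · rw [← h4 h8, h3]
            · rcases h7 with h7 | h7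
              · rw [← h4 h7, h3]
              · rw [h5 h8, h6 h7, h3]
          have h11 : f (.inr (i, true)) = f (.inl (Classical.arbitrary G.V)) := by
            rcases h9 with h9 | h9
            · rw [h6 h9, h3]
            · rw [← h5 h9, h10]
          cases b <;> assumption
      exact (h4 u).trans (h4 v).symm
    · have h3 := h.2
      rw [hc2] at h3
      refine (congrArg (· + 1) hc1).trans ?_
      rw [hcard, hsum z hz]
      omega

end MarkedGraph

namespace MarkedGraph

theorem sum_stringType_true {R : Type*} [CommRing R] (a b : Fin 5 → R) :
    (∑ c : Fin 5 → Bool, if stringType c = some true then ∏ k, (if c k then b k else a k) else 0) =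
    b 0 * b 4 * (b 1 * a 2 * a 3 + a 1 * b 2 * a 3 + a 1 * a 2 * b 3) := by
  rw [← Finset.sum_filter, filter_stringType_true, Finset.sum_insert (by decide),
    Finset.sum_insert (by decide), Finset.sum_singleton]
  simp [Fin.prod_univ_five]
  ring

theorem sum_stringType_false {R : Type*} [CommRing R] (a b : Fin 5 → R) :
    (∑ c : Fin 5 → Bool, if stringType c = some false then ∏ k, (if c k then b k else a k) else 0) =
    b 0 * b 4 * (a 1 * a 2 * a 3) +
      (b 0 * a 4 + a 0 * b 4) * (b 1 * a 2 * a 3 + a 1 * b 2 * a 3 + a 1 * a 2 * b 3) := by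
  rw [← Finset.sum_filter, filter_stringType_false, Finset.sum_insert (by decide),
    Finset.sum_insert (by decide), Finset.sum_insert (by decide), Finset.sum_insert (by decide),
    Finset.sum_insert (by decide), Finset.sum_insert (by decide), Finset.sum_singleton]
  simp [Fin.prod_univ_five]
  ring

section Bananify

variable {ι : Type} [Finite ι] (G : MarkedGraph ι) {R : Type*} [CommRing R]

/-- Spanning trees are grouped by their traces on the strings. Forests separating the ends of a
string play the role of an absent marked edge, trees of the string that of a present one. -/
theorem treePoly_bananify [Nonempty G.V] (a b : {e : G.E // e ∉ Set.range G.mark} ⊕ ι × Fin 5 → R) :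
    G.bananify.treePoly a b = G.treePoly
      (fun e => Sum.elim (fun e => a (.inl e)) (fun i => ∑ c : Fin 5 → Bool,
        if stringType c = some false then
          ∏ k, (if c k then b (.inr (i, k)) else a (.inr (i, k))) else 0) (G.edgeEquiv e))
      (fun e => Sum.elim (fun e => b (.inl e)) (fun i => ∑ c : Fin 5 → Bool,
        if stringType c = some true then
          ∏ k, (if c k then b (.inr (i, k)) else a (.inr (i, k))) else 0) (G.edgeEquiv e)) := by
  classical
  let U := {e : G.E // e ∉ Set.range G.mark}
  let _ := Fintype.ofFinite ι
  let _ := Fintype.ofFinite U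
  have h1 := G.bananify.treePoly_eq (Equiv.refl (U ⊕ ι × Fin 5)) a b
  have h2 := G.toMultigraph.treePoly_eq G.edgeEquiv
      (Sum.elim (fun e => a (.inl e)) (fun i => ∑ c : Fin 5 → Bool,
        if stringType c = some false then
          ∏ k, (if c k then b (.inr (i, k)) else a (.inr (i, k))) else 0))
      (Sum.elim (fun e => b (.inl e)) (fun i => ∑ c : Fin 5 → Bool,
        if stringType c = some true then
          ∏ k, (if c k then b (.inr (i, k)) else a (.inr (i, k))) else 0))
  refine h1.trans (Eq.trans ?_ h2.symm)
  rw [← (Equiv.sumArrowEquivProdArrow U ι Bool).symm.sum_comp, Fintype.sum_prod_type,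
    ← ((Equiv.sumArrowEquivProdArrow U (ι × Fin 5) Bool).trans (Equiv.prodCongr (Equiv.refl _)
      (Equiv.curry ι (Fin 5) Bool))).symm.sum_comp, Fintype.sum_prod_type]
  refine Finset.sum_congr rfl fun y _ => ?_
  have h3 := sum_configurations stringType
    (fun z : ι → Bool => G.IsSpanningTree {e | Sum.elim y z (G.edgeEquiv e) = true})
    (fun i c => ∏ k, if c k then b (.inr (i, k)) else a (.inr (i, k)))
  have h4 := congrArg ((∏ e, if y e then b (.inl e) else a (.inl e)) * ·) h3
  simp only [Finset.mul_sum, mul_ite, mul_zero] at h4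
  refine Eq.trans ?_ (h4.trans ?_)
  · refine Finset.sum_congr rfl fun c _ => if_congr ?_ ?_ rfl
    · exact G.bananify_tree_iff (Sum.elim y (fun p => c p.1 p.2))
    · rw [Fintype.prod_sum_type, Fintype.prod_prod_type]
      rfl
  · refine Finset.sum_congr rfl fun z _ => if_congr Iff.rfl ?_ rfl
    rw [Fintype.prod_sum_type]
    congr 1
    refine Finset.prod_congr rfl fun i _ => ?_
    change _ = if z i = true then _ else _
    cases z i <;> rfl

end Bananify

end MarkedGraph

/-! ### Iterated bananification as substitution of string networks. -/

namespace MarkedGraph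

section Iterate

variable {ι : Type} (G : MarkedGraph ι) [Finite ι]

/-- The variables of the bananification, in terms of those of a string of length `n + 1`. -/
def bananifyVar (n : ℕ) : {e : G.E // e ∉ Set.range G.mark} ⊕ ι × StringVar (n + 1) →
    {e : G.bananify.E // e ∉ Set.range G.bananify.mark} ⊕ ι × StringVar n
  | .inl e => .inl ⟨.inl e, by rintro ⟨i, h⟩; exact Sum.inr_ne_inl h⟩
  | .inr (i, none) => .inl ⟨.inr (i, 0), by
      rintro ⟨j, h⟩; exact absurd (congrArg Prod.snd (Sum.inr.inj h)) (by simp)⟩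
  | .inr (i, some none) => .inl ⟨.inr (i, 4), by
      rintro ⟨j, h⟩; exact absurd (congrArg Prod.snd (Sum.inr.inj h)) (by simp)⟩
  | .inr (i, some (some none)) => .inl ⟨.inr (i, 1), by
      rintro ⟨j, h⟩; exact absurd (congrArg Prod.snd (Sum.inr.inj h)) (by simp)⟩
  | .inr (i, some (some (some none))) => .inl ⟨.inr (i, 3), by
      rintro ⟨j, h⟩; exact absurd (congrArg Prod.snd (Sum.inr.inj h)) (by simp)⟩
  | .inr (i, some (some (some (some w)))) => .inr (i, w)

/-- The variables of the bananification are those of a string of length `n + 1`. -/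
def bananifyVarEquiv (n : ℕ) : {e : G.E // e ∉ Set.range G.mark} ⊕ ι × StringVar (n + 1) ≃
    {e : G.bananify.E // e ∉ Set.range G.bananify.mark} ⊕ ι × StringVar n where
  toFun := G.bananifyVar n
  invFun
    | .inl ⟨.inl e, _⟩ => .inl e
    | .inl ⟨.inr (i, k), _⟩ => .inr (i, (![none, some (some none), none,
        some (some (some none)), some none] : Fin 5 → StringVar (n + 1)) k)
    | .inr (i, w) => .inr (i, some (some (some (some w))))
  left_inv := by rintro (e | ⟨i, _ | _ | _ | _ | w⟩) <;> rfl
  right_inv := by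
    rintro (⟨e | ⟨i, k⟩, h⟩ | ⟨i, w⟩)
    · rfl
    · fin_cases k
      · rfl
      · rfl
      · exact absurd ⟨i, rfl⟩ h
      · rfl
      · rfl
    · rfl

end Iterate

/-- The induction runs over all `G`: the first step produces `G.bananify`, whose marked edges carry
strings of length `n` by induction. One application of `treePoly_bananify` then adds the outermost
layer, two parallel and two serial edges. -/
theorem exists_edgeEquiv_iterate {ι : Type} [Finite ι] {R : Type*} [CommRing R] (n : ℕ) :
    ∀ (G : MarkedGraph ι) [Nonempty G.V],
    ∃ φ : (bananify^[n] G).E ≃ {e : G.E // e ∉ Set.range G.mark} ⊕ ι × StringVar n,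
      ∀ v : {e : G.E // e ∉ Set.range G.mark} ⊕ ι × StringVar n → R,
      (bananify^[n] G).treePoly (v ∘ φ) 1 = G.treePoly
        (fun e => Sum.elim (fun e => v (.inl e))
          (fun i => (stringNet n fun w => v (.inr (i, w))).1) (G.edgeEquiv e))
        (fun e => Sum.elim (fun _ => 1)
          (fun i => (stringNet n fun w => v (.inr (i, w))).2) (G.edgeEquiv e)) := by
  induction n with
  | zero =>
    intro G _
    refine ⟨G.edgeEquiv.trans (Equiv.sumCongr (Equiv.refl _) (Equiv.prodPUnit ι).symm),
      fun v => ?_⟩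
    change G.treePoly _ _ = _
    congr 1
    · funext e
      change v (Sum.map id (Equiv.prodPUnit ι).symm (G.edgeEquiv e)) = _
      cases G.edgeEquiv e <;> rfl
    · funext e
      cases G.edgeEquiv e <;> rfl
  | succ n ih =>
    intro G _
    have hV : Nonempty G.bananify.V := ⟨.inl (Classical.arbitrary G.V)⟩
    obtain ⟨φ, hφ⟩ := ih G.bananify
    refine ⟨φ.trans (G.bananifyVarEquiv n).symm, fun v => ?_⟩
    refine ((hφ (v ∘ (G.bananifyVarEquiv n).symm)).trans
      (G.treePoly_bananify _ _)).trans ?_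
    have hu (e : G.bananify.E) (h : e ∉ Set.range G.bananify.mark) :=
      G.bananify.edgeEquiv_of_not_mem h
    have h2 (i : ι) : G.bananify.edgeEquiv (.inr (i, 2)) = .inr i := G.bananify.edgeEquiv_mark i
    have hk (i : ι) (k : Fin 5) (hk : k ≠ 2) : G.bananify.edgeEquiv (.inr (i, k)) =
        .inl ⟨.inr (i, k), fun ⟨j, h⟩ => hk (congrArg Prod.snd (Sum.inr.inj h)).symm⟩ := hu _ _
    have hl (e) : G.bananify.edgeEquiv (.inl e) =
        .inl ⟨.inl e, fun ⟨j, h⟩ => Sum.inr_ne_inl h⟩ := hu _ _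
    congr 1
    · funext e
      rcases G.edgeEquiv e with e | i
      · simp only [Sum.elim_inl, hl]
        rfl
      · simp only [Sum.elim_inr, sum_stringType_false, h2, hk i 0 (by decide),
          hk i 1 (by decide), hk i 3 (by decide), hk i 4 (by decide), Sum.elim_inl]
        simp only [stringNet, serialEdge, parallelEdge, Function.comp_apply]
        simp only [bananifyVarEquiv, Equiv.coe_fn_symm_mk, Matrix.cons_val]
        ring
    · funext e
      rcases G.edgeEquiv e with e | i
      · simp only [Sum.elim_inl, hl]
      · simp only [Sum.elim_inr, sum_stringType_true, h2, hk i 0 (by decide),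
          hk i 1 (by decide), hk i 3 (by decide), hk i 4 (by decide), Sum.elim_inl]
        simp only [stringNet, serialEdge, parallelEdge, Function.comp_apply]
        simp only [bananifyVarEquiv, Equiv.coe_fn_symm_mk, Matrix.cons_val]
        ring

end MarkedGraph

/-! ### Spanning trees of bananas and necklaces. -/

theorem sum_ite_exists_eq {α β R : Type*} [Fintype α] [Fintype β] [CommRing R]
    {g : α → β} (hg : g.Injective) (F : β → R) [DecidablePred fun x => ∃ i, x = g i] :
    (∑ x, if ∃ i, x = g i then F x else 0) = ∑ i, F (g i) := by
  classical
  rw [← Finset.sum_filter, ← Finset.sum_image fun i _ j _ h => hg h]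
  refine Finset.sum_congr ?_ fun _ _ => rfl
  ext x
  simp [eq_comm]

theorem exists_eq_decide_of_sum_eq_one {α : Type*} [Fintype α] [DecidableEq α] {x : α → Bool}
    (h : ∑ i, (x i).toNat = 1) : ∃ i, x = fun j => decide (j = i) := by
  have h1 : (Finset.univ.filter (x · = true)).card = 1 := by
    rw [Finset.card_filter]
    exact (Finset.sum_congr rfl fun i _ => by cases x i <;> rfl).trans h
  obtain ⟨i, hi⟩ := Finset.card_eq_one.mp h1
  refine ⟨i, funext fun j => ?_⟩
  have h2 := Finset.ext_iff.mp hi j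
  simp only [Finset.mem_filter, Finset.mem_univ, true_and, Finset.mem_singleton] at h2
  rw [Bool.eq_iff_iff, h2, decide_eq_true_iff]

namespace Multigraph

/-- Two vertices joined by parallel edges. -/
def banana (E : Type) [Finite E] : Multigraph where
  V := Bool
  E := E
  src _ := false
  tgt _ := true

theorem banana_tree_iff {E : Type} [Fintype E] [DecidableEq E] (x : E → Bool) :
    (banana E).IsSpanningTree {e | x e = true} ↔ ∃ i, x = fun j => decide (j = i) := by
  have : Nonempty (banana E).V := ⟨false⟩
  have hV : Nat.card (banana E).V = 2 := (Nat.card_eq_fintype_card (α := Bool)).trans Fintype.card_bool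
  have hS : Nat.card {e : (banana E).E | x e = true} = ∑ e, (x e).toNat :=
    card_setOf_eq_sum (Equiv.refl E) x
  rw [isSpanningTree_iff, hV, hS]
  constructor
  · rintro ⟨-, h⟩
    exact exists_eq_decide_of_sum_eq_one (by omega)
  · rintro ⟨i, rfl⟩
    refine ⟨fun u v => ?_, ?_⟩
    · have h : (banana E).Joined {e : E | decide (e = i) = true} false true :=
        .rel _ _ ⟨i, decide_eq_true rfl, rfl, rfl⟩
      cases u <;> cases v
      exacts [.refl _, h, h.symm _ _, .refl _]
    · rw [Finset.sum_eq_single i (fun j _ hj => by simp [hj]) (by simp)]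
      simp

theorem treePoly_banana {E : Type} {R : Type*} [Fintype E] [DecidableEq E] [CommRing R] (a b : E → R) :
    (banana E).treePoly a b = ∑ i, ∏ j, if j = i then b j else a j := by
  classical
  refine ((banana E).treePoly_eq (Equiv.refl E) a b).trans ?_
  have h := sum_ite_exists_eq (g := fun i j : E => decide (j = i))
    (fun i j h => by simpa using congrFun h i) fun x => ∏ f, if x f then b f else a f
  simp only [decide_eq_true_iff] at h
  rw [← h]
  exact Finset.sum_congr rfl fun x _ => if_congr (banana_tree_iff x) rfl rfl

end Multigraph

namespace MarkedGraph

/-- The ways in which a spanning tree can meet one of the triple edges of a necklace and the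
single edge that follows it: two edges that join both ends, or only one edge. -/
def linkType (c : Fin 4 → Bool) : Option Bool :=
  if 1 < (c 0).toNat + (c 1).toNat + (c 2).toNat then none
  else if ∑ k, (c k).toNat = 2 then some true
  else if ∑ k, (c k).toNat = 1 then some false else none

theorem linkType_spec : ∀ (c : Fin 4 → Bool) (z : Bool), linkType c = some z →
    ∑ k, (c k).toNat = 1 + z.toNat := by
  decide

theorem linkType_connected : ∀ (c : Fin 4 → Bool), linkType c = some true →
    c 3 = true ∧ (c 0 = true ∨ c 1 = true ∨ c 2 = true) := by
  decide

theorem linkType_half : ∀ (c : Fin 4 → Bool), linkType c = some false →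
    c 3 = true ∨ (c 0 = true ∨ c 1 = true ∨ c 2 = true) := by
  decide

theorem sum_toNat_le_two : ∀ c : Fin 4 → Bool, ¬ (c 0 = true ∧ c 1 = true) →
    ¬ (c 0 = true ∧ c 2 = true) → ¬ (c 1 = true ∧ c 2 = true) → ∑ k, (c k).toNat ≤ 2 := by
  decide

theorem exists_linkType : ∀ c : Fin 4 → Bool, ¬ (c 0 = true ∧ c 1 = true) →
    ¬ (c 0 = true ∧ c 2 = true) → ¬ (c 1 = true ∧ c 2 = true) → ∑ k, (c k).toNat ≠ 0 →
    (linkType c).isSome := by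
  decide

theorem filter_linkType_true : Finset.univ.filter (linkType · = some true) =
    {![true, false, false, true], ![false, true, false, true], ![false, false, true, true]} := by
  decide

theorem filter_linkType_false : Finset.univ.filter (linkType · = some false) =
    {![false, false, false, true], ![true, false, false, false], ![false, true, false, false],
      ![false, false, true, false]} := by
  decide

theorem sum_linkType_true {R : Type*} [CommRing R] (a b : Fin 4 → R) :
    (∑ c : Fin 4 → Bool, if linkType c = some true then ∏ k, (if c k then b k else a k) else 0) =
    b 3 * (b 0 * a 1 * a 2 + a 0 * b 1 * a 2 + a 0 * a 1 * b 2) := by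
  rw [← Finset.sum_filter, filter_linkType_true, Finset.sum_insert (by decide),
    Finset.sum_insert (by decide), Finset.sum_singleton]
  simp [Fin.prod_univ_four]
  ring

theorem sum_linkType_false {R : Type*} [CommRing R] (a b : Fin 4 → R) :
    (∑ c : Fin 4 → Bool, if linkType c = some false then ∏ k, (if c k then b k else a k) else 0) =
    b 3 * (a 0 * a 1 * a 2) +
      a 3 * (b 0 * a 1 * a 2 + a 0 * b 1 * a 2 + a 0 * a 1 * b 2) := by
  rw [← Finset.sum_filter, filter_linkType_false, Finset.sum_insert (by decide),
    Finset.sum_insert (by decide), Finset.sum_insert (by decide), Finset.sum_singleton]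
  simp [Fin.prod_univ_four]
  ring

/-- With `2 (s + 1)` vertices a tree has `2 (s + 1) - 1` edges, and each link holds at most two of
them. Hence exactly one link holds one edge and all the others hold two. -/
theorem necklace_tree_iff (s : ℕ) (x : Fin (s + 1) × Fin 4 → Bool) :
    (necklace (s + 1)).IsSpanningTree {e | x e = true} ↔
      ∃ z : Fin (s + 1) → Bool, (∃ i, z = fun j => !decide (j = i)) ∧
        ∀ i, linkType (fun k => x (i, k)) = some (z i) := by
  have hN : Nonempty (necklace (s + 1)).V := ⟨((0 : Fin (s + 1)), false)⟩
  have hV : Nat.card (necklace (s + 1)).V = 2 * (s + 1) := by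
    change Nat.card (Fin (s + 1) × Bool) = _
    rw [Nat.card_prod, Nat.card_eq_fintype_card, Nat.card_eq_fintype_card, Fintype.card_bool,
      Fintype.card_fin, mul_comm]
  have hS : Nat.card {e : (necklace (s + 1)).E | x e = true} =
      ∑ i, ∑ k, (x (i, k)).toNat :=
    (Multigraph.card_setOf_eq_sum (Equiv.refl (Fin (s + 1) × Fin 4)) x).trans
      (Fintype.sum_prod_type _)
  constructor
  · intro h
    have hp (i : Fin (s + 1)) (k l : Fin 4) (hkl : l ≠ k)
        (h1 : (necklace (s + 1)).src (i, l) = (necklace (s + 1)).src (i, k))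
        (h2 : (necklace (s + 1)).tgt (i, l) = (necklace (s + 1)).tgt (i, k)) :
        ¬ (x (i, k) = true ∧ x (i, l) = true) := fun ⟨h3, h4⟩ =>
      h.not_parallel (e := (i, k)) (e' := (i, l)) h3 h4 (fun h5 => hkl (congrArg Prod.snd h5)) h1 h2
    have h01 (i) := hp i 0 1 (by decide) rfl rfl
    have h02 (i) := hp i 0 2 (by decide) rfl rfl
    have h12 (i) := hp i 1 2 (by decide) rfl rfl
    have hle (i) := sum_toNat_le_two (fun k => x (i, k)) (h01 i) (h02 i) (h12 i)
    have hcount := ((Multigraph.isSpanningTree_iff _ _).mp h).2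
    rw [hV, hS] at hcount
    have hne (i) : ∑ k, (x (i, k)).toNat ≠ 0 := by
      intro h0
      rw [← Finset.add_sum_erase _ _ (Finset.mem_univ i), h0] at hcount
      have h1 := Finset.sum_le_card_nsmul (Finset.univ.erase i) (fun i => ∑ k, (x (i, k)).toNat) 2
        fun i _ => hle i
      rw [Finset.card_erase_of_mem (Finset.mem_univ i), Finset.card_univ, Fintype.card_fin,
        smul_eq_mul] at h1
      omega
    choose z hz using fun i => Option.isSome_iff_exists.mp
      (exists_linkType (fun k => x (i, k)) (h01 i) (h02 i) (h12 i) (hne i))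
    have hsum (i) : ∑ k, (x (i, k)).toNat = 1 + (z i).toNat := linkType_spec _ _ (hz i)
    have hadd : ∑ i, (z i).toNat + ∑ i, (!z i).toNat = s + 1 := by
      rw [← Finset.sum_add_distrib, Finset.sum_congr rfl (g := fun _ => 1)
        fun i _ => by cases z i <;> rfl]
      simp
    simp only [hsum, Finset.sum_add_distrib, Finset.sum_const, Finset.card_univ, Fintype.card_fin,
      smul_eq_mul, mul_one] at hcount
    obtain ⟨i, hi⟩ := exists_eq_decide_of_sum_eq_one (x := fun i => !z i) (by omega)
    refine ⟨z, ⟨i, funext fun j => ?_⟩, hz⟩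
    rw [← congrFun hi j, Bool.not_not]
  · rintro ⟨z, ⟨i, rfl⟩, hz⟩
    have hfull (j) (hj : j ≠ i) := linkType_connected _ ((hz j).trans (by simp [hj]))
    have hhalf := linkType_half _ ((hz i).trans (by simp))
    rw [Multigraph.isSpanningTree_iff]
    refine ⟨fun u v => (Multigraph.joined_iff _ _ _ _).mpr fun f hf => ?_, ?_⟩
    · change Fin (s + 1) × Bool → ZMod 2 at f
      have h3 (j) (h : x (j, 3) = true) : f (finRotate (s + 1) j, false) = f (j, true) :=
        (hf (j, 3) h).symm
      have h0 (j) (h : x (j, 0) = true ∨ x (j, 1) = true ∨ x (j, 2) = true) :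
          f (j, true) = f (j, false) := by
        rcases h with h | h | h
        exacts [(hf (j, 0) h).symm, (hf (j, 1) h).symm, (hf (j, 2) h).symm]
      -- The differences of `f` around the cycle add up to zero and vanish on every link but the
      -- `i`-th. There one of the two differences vanishes, hence so does the other.
      have hsum : ∑ j, ((f (finRotate (s + 1) j, false) - f (j, true)) +
          (f (j, true) - f (j, false))) = 0 := by
        simp only [sub_add_sub_cancel, Finset.sum_sub_distrib]
        rw [Equiv.sum_comp (finRotate (s + 1)) fun j => f (j, false), sub_self]
      rw [Finset.sum_eq_single i (fun j _ hj => by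
        rw [h3 j (hfull j hj).1, h0 j (hfull j hj).2, sub_self, zero_add]) (by simp)]
        at hsum
      have hi : f (finRotate (s + 1) i, false) = f (i, true) ∧ f (i, true) = f (i, false) := by
        rcases hhalf with h | h
        · rw [h3 i h, sub_self, zero_add, sub_eq_zero] at hsum
          exact ⟨h3 i h, hsum⟩
        · rw [h0 i h, sub_self, add_zero, sub_eq_zero] at hsum
          exact ⟨hsum.trans (h0 i h).symm, h0 i h⟩
      have hall (j) : f (finRotate (s + 1) j, false) = f (j, true) ∧ f (j, true) = f (j, false) := by
        by_cases hj : j = i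
        · rw [hj]; exact hi
        · exact ⟨h3 j (hfull j hj).1, h0 j (hfull j hj).2⟩
      have hconst (j : Fin (s + 1)) : f (j, false) = f (0, false) := by
        induction j using Fin.induction with
        | zero => rfl
        | succ j ih =>
          have h := (hall j.castSucc).1.trans (hall j.castSucc).2
          rw [finRotate_apply, Fin.coeSucc_eq_succ] at h
          exact h.trans ih
      have hconst' (v : Fin (s + 1) × Bool) : f v = f (0, false) := by
        rcases v with ⟨j, _ | _⟩
        · exact hconst j
        · rw [(hall j).2, hconst j]
      exact (hconst' u).trans (hconst' v).symm
    · have hsum (j) : ∑ k, (x (j, k)).toNat = 1 + (!decide (j = i)).toNat := linkType_spec _ _ (hz j)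
      rw [hV, hS]
      have h1 : ∑ j, (!decide (j = i)).toNat = s := by
        rw [← Finset.add_sum_erase _ _ (Finset.mem_univ i), Finset.sum_congr rfl (g := fun _ => 1)
          fun j hj => by simp [Finset.ne_of_mem_erase hj]]
        simp
      simp only [hsum, Finset.sum_add_distrib, h1, Finset.sum_const, Finset.card_univ,
        Fintype.card_fin, smul_eq_mul, mul_one]
      omega

theorem treePoly_necklace {R : Type*} [CommRing R] (s : ℕ) (a b : Fin (s + 1) × Fin 4 → R) :
    (necklace (s + 1)).treePoly a b = closedChain fun i =>
      (b (i, 3) * (a (i, 0) * a (i, 1) * a (i, 2)) + a (i, 3) * (b (i, 0) * a (i, 1) * a (i, 2) +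
        a (i, 0) * b (i, 1) * a (i, 2) + a (i, 0) * a (i, 1) * b (i, 2)),
      b (i, 3) * (b (i, 0) * a (i, 1) * a (i, 2) + a (i, 0) * b (i, 1) * a (i, 2) +
        a (i, 0) * a (i, 1) * b (i, 2))) := by
  classical
  refine ((necklace (s + 1)).treePoly_eq (Equiv.refl (Fin (s + 1) × Fin 4)) a b).trans ?_
  have h := sum_configurations linkType (fun z : Fin (s + 1) → Bool => ∃ i, z = fun j => !decide (j = i))
    (fun i c => ∏ k, if c k then b (i, k) else a (i, k))
  rw [sum_ite_exists_eq (fun i j h => by simpa using congrFun h i)] at h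
  rw [← (Equiv.curry (Fin (s + 1)) (Fin 4) Bool).symm.sum_comp]
  refine Eq.trans (Finset.sum_congr rfl fun c _ => if_congr ?_ ?_ rfl) (h.trans ?_)
  · exact necklace_tree_iff s fun p => c p.1 p.2
  · rw [Fintype.prod_prod_type]
    rfl
  · refine Finset.sum_congr rfl fun i _ => Finset.prod_congr rfl fun j _ => ?_
    by_cases hj : j = i
    · simp only [hj, decide_true, Bool.not_true, sum_linkType_false, if_true]
    · simp only [hj, decide_false, Bool.not_false, sum_linkType_true, if_false]

end MarkedGraph

/-! ### The three families of graphs as classes of network polynomials. -/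

section GraphClasses

open MvPolynomial Multigraph MarkedGraph

variable (K : Type u) [Field K]

/-- The relabelling `ψ` is free, so that for each family the variables can be chosen to match those
of the generic networks. -/
theorem grothendieckClass_iterate {ι : Type} [Finite ι] (n : ℕ) (G : MarkedGraph ι) [Nonempty G.V]
    {τ : Type} [Finite τ] (ψ : {e : G.E // e ∉ Set.range G.mark} ⊕ ι × StringVar n ≃ τ) :
    grothendieckClass K (bananify^[n] G).toMultigraph =
      complClass (G.treePoly (R := MvPolynomial τ K)
        (fun e => Sum.elim (fun e => X (ψ (.inl e)))
          (fun i => (stringNet n fun w => X (ψ (.inr (i, w)))).1) (G.edgeEquiv e))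
        (fun e => Sum.elim (fun _ => 1)
          (fun i => (stringNet n fun w => X (ψ (.inr (i, w)))).2) (G.edgeEquiv e))) := by
  obtain ⟨φ, hφ⟩ := exists_edgeEquiv_iterate (R := MvPolynomial τ K) n G
  change complClass ((bananify^[n] G).kirchhoff K) = _
  rw [kirchhoff_eq_treePoly, ← complClass_rename (φ.trans ψ)]
  refine congrArg complClass (Eq.trans ?_ (hφ fun x => X (ψ x)))
  refine ((bananify^[n] G).map_treePoly
    (rename (φ.trans ψ) : MvPolynomial _ K →ₐ[K] MvPolynomial τ K).toRingHom X 1).trans ?_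
  congr 1
  · funext e
    simp
  · funext e
    simp

theorem grothendieckClass_Gamma (n : ℕ) :
    grothendieckClass K (.Gamma n) = complClass (genericString K n).2 := by
  have : Nonempty singleEdge.V := ⟨false⟩
  have : IsEmpty {e : singleEdge.E // e ∉ Set.range singleEdge.mark} :=
    ⟨fun e => e.2 ⟨(), rfl⟩⟩
  refine (grothendieckClass_iterate K n singleEdge
    ((Equiv.emptySum _ _).trans (Equiv.punitProd (StringVar n)))).trans (congrArg complClass ?_)
  refine (treePoly_banana (E := Unit) _ _).trans ?_
  have h : singleEdge.edgeEquiv () = .inr () := singleEdge.edgeEquiv_mark ()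
  simp only [Finset.univ_unique, Finset.sum_singleton, Finset.prod_singleton, if_true]
  change Sum.elim _ _ (singleEdge.edgeEquiv ()) = _
  rw [h]
  rfl

/-- The variables of a vacuum graph, with the three unmarked edges of the `4`-banana last. -/
def fourBananaVarEquiv (α : Type) :
    {e : fourBanana.E // e ∉ Set.range fourBanana.mark} ⊕ Unit × α ≃ Option (Option (Option α)) where
  toFun
    | .inl ⟨e, _⟩ => (![none, none, some none, some (some none)] : Fin 4 → Option (Option (Option α))) e
    | .inr (_, w) => some (some (some w))
  invFun
    | none => .inl ⟨(1 : Fin 4), by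
        rintro ⟨_, h⟩; exact absurd h (show ¬ (0 : Fin 4) = 1 by decide)⟩
    | some none => .inl ⟨(2 : Fin 4), by
        rintro ⟨_, h⟩; exact absurd h (show ¬ (0 : Fin 4) = 2 by decide)⟩
    | some (some none) => .inl ⟨(3 : Fin 4), by
        rintro ⟨_, h⟩; exact absurd h (show ¬ (0 : Fin 4) = 3 by decide)⟩
    | some (some (some w)) => .inr ((), w)
  left_inv := by
    rintro (⟨e, h⟩ | ⟨_, w⟩)
    · change Fin 4 at e
      fin_cases e
      · exact absurd ⟨(), rfl⟩ h
      all_goals rfl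
    · rfl
  right_inv := by rintro (_ | _ | _ | w) <;> rfl

theorem grothendieckClass_iterate_fourBanana (n : ℕ) :
    grothendieckClass K (bananify^[n] fourBanana).toMultigraph =
      complClass (parallelEdge (liftPair (genericCircle K n)) (X none)).2 := by
  have : Nonempty fourBanana.V := ⟨false⟩
  refine (grothendieckClass_iterate K n fourBanana (fourBananaVarEquiv _)).trans
    (congrArg complClass ?_)
  refine (treePoly_banana (E := Fin 4) _ _).trans ?_
  have hu (k : Fin 4) (hk : k ≠ 0) : fourBanana.edgeEquiv k =
      .inl ⟨k, by rintro ⟨_, h⟩; exact hk h.symm⟩ := fourBanana.edgeEquiv_of_not_mem _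
  have h0 : fourBanana.edgeEquiv (0 : Fin 4) = .inr () := fourBanana.edgeEquiv_mark ()
  simp only [Fin.sum_univ_four, Fin.prod_univ_four]
  simp only [genericCircle, liftPair_parallelEdge, liftPair_stringNet, rename_X]
  simp [h0, hu 1 (by decide), hu 2 (by decide), hu 3 (by decide), fourBananaVarEquiv, parallelEdge]
  ring

/-- The variables of a star, with the unmarked edges of the necklace last. -/
def necklaceVarEquiv (s : ℕ) (α : Type) :
    {e : (necklace s).E // e ∉ Set.range (necklace s).mark} ⊕ Fin s × α ≃
      Fin s × Option (Option (Option α)) where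
  toFun
    | .inl ⟨(i, k), _⟩ =>
      (i, (![none, some none, some (some none), none] : Fin 4 → Option (Option (Option α))) k)
    | .inr (i, w) => (i, some (some (some w)))
  invFun
    | (i, none) => .inl ⟨(i, (3 : Fin 4)), by
        rintro ⟨_, h⟩; exact absurd (congrArg Prod.snd h) (show ¬ (0 : Fin 4) = 3 by decide)⟩
    | (i, some none) => .inl ⟨(i, (1 : Fin 4)), by
        rintro ⟨_, h⟩; exact absurd (congrArg Prod.snd h) (show ¬ (0 : Fin 4) = 1 by decide)⟩
    | (i, some (some none)) => .inl ⟨(i, (2 : Fin 4)), by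
        rintro ⟨_, h⟩; exact absurd (congrArg Prod.snd h) (show ¬ (0 : Fin 4) = 2 by decide)⟩
    | (i, some (some (some w))) => .inr (i, w)
  left_inv := by
    rintro (⟨⟨i, k⟩, h⟩ | ⟨i, w⟩)
    · fin_cases k
      · exact absurd ⟨i, rfl⟩ h
      all_goals rfl
    · rfl
  right_inv := by rintro ⟨i, _ | _ | _ | w⟩ <;> rfl

variable {K} {σ : Type} in
theorem copyPair_serialEdge {s : ℕ} (p : MvPolynomial σ K × MvPolynomial σ K)
    (x : MvPolynomial σ K) (i : Fin s) : copyPair (serialEdge p x) i =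
      serialEdge (copyPair p i) (rename (Prod.mk i) x) :=
  map_serialEdge (rename (Prod.mk i) : _ →ₐ[K] MvPolynomial (Fin s × σ) K).toRingHom p x

variable {K} {σ : Type} in
theorem copyPair_parallelEdge {s : ℕ} (p : MvPolynomial σ K × MvPolynomial σ K)
    (x : MvPolynomial σ K) (i : Fin s) : copyPair (parallelEdge p x) i =
      parallelEdge (copyPair p i) (rename (Prod.mk i) x) :=
  map_parallelEdge (rename (Prod.mk i) : _ →ₐ[K] MvPolynomial (Fin s × σ) K).toRingHom p x

variable {K} {σ : Type} in
theorem copyPair_stringNet {s : ℕ} (n : ℕ) (w : StringVar n → MvPolynomial σ K) (i : Fin s) :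
    copyPair (stringNet n w) i = stringNet n fun j => rename (Prod.mk i) (w j) :=
  map_stringNet (rename (Prod.mk i) : _ →ₐ[K] MvPolynomial (Fin s × σ) K).toRingHom n w

theorem grothendieckClass_iterate_necklace (s n : ℕ) :
    grothendieckClass K (bananify^[n] (necklace (s + 1))).toMultigraph =
      complClass (closedChain (copyPair (s := s + 1)
        (serialEdge (liftPair (genericCircle K n)) (X none)))) := by
  have : Nonempty (necklace (s + 1)).V := ⟨((0 : Fin (s + 1)), false)⟩
  refine (grothendieckClass_iterate K n (necklace (s + 1)) (necklaceVarEquiv _ _)).trans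
    (congrArg complClass ?_)
  refine (treePoly_necklace s _ _).trans (congrArg closedChain (funext fun i => ?_))
  have hu (k : Fin 4) (hk : k ≠ 0) : (necklace (s + 1)).edgeEquiv (i, k) =
      .inl ⟨(i, k), by rintro ⟨_, h⟩; exact hk (congrArg Prod.snd h).symm⟩ :=
    (necklace (s + 1)).edgeEquiv_of_not_mem _
  have h0 : (necklace (s + 1)).edgeEquiv (i, (0 : Fin 4)) = .inr i :=
    (necklace (s + 1)).edgeEquiv_mark i
  have h : copyPair (s := s + 1) (serialEdge (liftPair (genericCircle K n)) (X none)) i =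
      serialEdge (parallelEdge (parallelEdge
        (stringNet n fun w => X (i, some (some (some w)))) (X (i, some (some none))))
        (X (i, some none))) (X (i, none)) := by
    simp only [genericCircle, liftPair_parallelEdge, liftPair_stringNet, copyPair_serialEdge,
      copyPair_parallelEdge, copyPair_stringNet, rename_X]
  rw [h]
  simp only [h0, hu 1 (by decide), hu 2 (by decide), hu 3 (by decide), Sum.elim_inl, Sum.elim_inr]
  refine Prod.ext ?_ ?_
  · simp [necklaceVarEquiv, serialEdge, parallelEdge]
    ring
  · simp [necklaceVarEquiv, serialEdge, parallelEdge]
    ring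

theorem grothendieckClass_Star (s n : ℕ) : ∃ β δ : K0 K,
    grothendieckClass K (.Star (s + 1) (n + 1)) = ((torusClass K + 1) * β) ^ s *
      (torusClass K * β + (s + 1) * (torusClass K + 1) * δ) ∧
    β = torusClass K ^ (n + 1) * (torusClass K + 1) ^ (2 * n + 1) *
      Polynomial.aeval (torusClass K) (chainBG (n + 1)).1 ∧
    δ = torusClass K ^ (n + 1) * (torusClass K + 1) ^ (2 * n) *
      Polynomial.aeval (torusClass K) (chainBG (n + 1)).2 := by
  obtain ⟨α, π, h, hδ⟩ := genericCircle_hasClasses (K := K) n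
  exact ⟨_, _, (grothendieckClass_iterate_necklace K s n).trans (complClass_closedChain h s),
    rfl, hδ⟩

end GraphClasses

/-! ### The polynomials `σ^s_n` and the recursion of the chains. -/

section StarPolynomials

open Polynomial

theorem mul_starDen (F : PowerSeries ℤ[X]) : F * starDen =
    F - PowerSeries.C (2 + X) * (F * PowerSeries.X) +
      PowerSeries.C 2 * (F * PowerSeries.X * PowerSeries.X) := by
  rw [starDen, map_ofNat]
  ring

theorem coeff_starSeries_zero (s : ℕ) : PowerSeries.coeff 0 (starSeries s) = 1 := by
  have h := congrArg (PowerSeries.coeff 0) (starSeries_mul_starDen s)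
  simpa [starDen, starNum] using h

theorem coeff_starNum_succ (s n : ℕ) : PowerSeries.coeff (n + 1) (starNum s) =
    if n = 0 then -2 else if n = 1 then ((s : ℤ[X]) - 1) * X - ((s : ℤ[X]) - 2) else 0 := by
  have h : starNum s = 1 - PowerSeries.C 2 * PowerSeries.X +
      PowerSeries.C (((s : ℤ[X]) - 1) * X - ((s : ℤ[X]) - 2)) * PowerSeries.X ^ 2 := by
    rw [starNum, map_ofNat]
  rw [h, map_add, map_sub, PowerSeries.coeff_C_mul, PowerSeries.coeff_C_mul,
    PowerSeries.coeff_one, PowerSeries.coeff_X, PowerSeries.coeff_X_pow]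
  rcases n with _ | _ | n <;> simp

theorem starPoly_zero (s : ℕ) : starPoly s 0 = X := by
  have h := congrArg (PowerSeries.coeff (0 + 1)) (starSeries_mul_starDen s)
  rw [mul_starDen, coeff_starNum_succ, map_add, map_sub, PowerSeries.coeff_C_mul,
    PowerSeries.coeff_C_mul, PowerSeries.coeff_succ_mul_X, PowerSeries.coeff_succ_mul_X,
    PowerSeries.coeff_zero_mul_X, coeff_starSeries_zero, if_pos rfl] at h
  rw [starPoly]
  linear_combination h

/-- The middle term is a bare coefficient because for `n = 0` it is the constant term `1` of the
series, which is not a `starPoly`. -/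
theorem starPoly_recurrence (s n : ℕ) : starPoly s (n + 1) = (2 + X) * starPoly s n -
    2 * PowerSeries.coeff n (starSeries s) + PowerSeries.coeff (n + 2) (starNum s) := by
  have h := congrArg (PowerSeries.coeff (n + 1 + 1)) (starSeries_mul_starDen s)
  rw [mul_starDen, map_add, map_sub, PowerSeries.coeff_C_mul, PowerSeries.coeff_C_mul,
    PowerSeries.coeff_succ_mul_X, PowerSeries.coeff_succ_mul_X, PowerSeries.coeff_succ_mul_X] at h
  rw [starPoly, starPoly]
  linear_combination h

/-- By Cayley-Hamilton the pairs `chainBG` satisfy `u_{n+2} = (2 + t) u_{n+1} - 2 u_n`, the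
recurrence given by `starDen`. The numerator only affects the initial values. -/
theorem starPoly_eq (s : ℕ) : ∀ n, starPoly s n = X * (chainBG n).1 + (s : ℤ[X]) * (chainBG n).2
  | 0 => by simp [starPoly_zero, chainBG]
  | 1 => by
    rw [starPoly_recurrence, starPoly_zero, coeff_starSeries_zero, coeff_starNum_succ]
    simp [chainBG]
    ring
  | n + 2 => by
    rw [starPoly_recurrence, coeff_starNum_succ, starPoly_eq s (n + 1)]
    change _ - 2 * starPoly s n + _ = _
    rw [starPoly_eq s n]
    simp only [chainBG_succ]
    simp
    ring

theorem chainBG_add (m n : ℕ) :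
    X * (chainBG (m + n)).1 + (chainBG (m + n)).2 = X * (chainBG m).1 * (chainBG n).1 +
      (chainBG m).1 * (chainBG n).2 + (chainBG m).2 * (chainBG n).1 := by
  induction m generalizing n with
  | zero => simp [chainBG]
  | succ m ih =>
    -- The right-hand side is a symmetric bilinear form in the two pairs for which the matrix of the
    -- recursion is self-adjoint, so a step can be moved from `m` to `n`.
    rw [Nat.succ_add_eq_add_succ, ih (n + 1)]
    simp only [chainBG_succ]
    ring

end StarPolynomials

/-! ### Comparison of the classes. -/

theorem mainTheorem8 (K : Type*) [Field K] (s n : ℕ) (hs : 1 ≤ s) (hn : 1 ≤ n) :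
    (s ≤ 2 * n →
      grothendieckClass K (.Star s n) =
        torusClass K ^ n * (torusClass K + 1) ^ (2 * n - s) *
          grothendieckClass K (.Gamma n) ^ (s - 1) *
          Polynomial.aeval (torusClass K) (starPoly s n)) ∧
    (2 * n ≤ s →
      (torusClass K + 1) ^ (s - 2 * n) * grothendieckClass K (.Star s n) =
        torusClass K ^ n * grothendieckClass K (.Gamma n) ^ (s - 1) *
          Polynomial.aeval (torusClass K) (starPoly s n)) ∧
    (s ≤ 2 * n →
      ∃ q : Polynomial ℤ, grothendieckClass K (.Star s n) =
        grothendieckClass K (.Gamma n) ^ (s - 1) * Polynomial.aeval (torusClass K) q) ∧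
    (∃ q : Polynomial ℤ, grothendieckClass K (.GammaVac (2 * n + 1)) =
        grothendieckClass K (.Gamma n) * Polynomial.aeval (torusClass K) q) := by
  obtain ⟨t, rfl⟩ := Nat.exists_eq_add_of_le' hs
  obtain ⟨m, rfl⟩ := Nat.exists_eq_add_of_le' hn
  obtain ⟨β, δ, hStar, hβ, hδ⟩ := grothendieckClass_Star K t m
  have hΓ : grothendieckClass K (.Gamma (m + 1)) = (torusClass K + 1) * ((torusClass K + 1) * β) := by
    rw [grothendieckClass_Gamma, complClass_genericString_snd, hβ]
    ring
  have hstarPoly : Polynomial.aeval (torusClass K) (starPoly (t + 1) (m + 1)) =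
      torusClass K * Polynomial.aeval (torusClass K) (chainBG (m + 1)).1 +
        (t + 1) * Polynomial.aeval (torusClass K) (chainBG (m + 1)).2 := by
    rw [starPoly_eq]
    simp
  have hlast : torusClass K * β + (t + 1) * (torusClass K + 1) * δ = torusClass K ^ (m + 1) *
      (torusClass K + 1) ^ (2 * m + 1) *
        Polynomial.aeval (torusClass K) (starPoly (t + 1) (m + 1)) := by
    rw [hstarPoly, hβ, hδ]
    ring
  have h1 (h : t + 1 ≤ 2 * (m + 1)) : grothendieckClass K (.Star (t + 1) (m + 1)) =
      torusClass K ^ (m + 1) * (torusClass K + 1) ^ (2 * (m + 1) - (t + 1)) *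
        grothendieckClass K (.Gamma (m + 1)) ^ t *
        Polynomial.aeval (torusClass K) (starPoly (t + 1) (m + 1)) := by
    obtain ⟨d, hd⟩ := Nat.exists_eq_add_of_le h
    -- Each of the `t = s - 1` factors `𝕌(Γ_n) = (𝕋 + 1) ((𝕋 + 1) β)` takes one power of `𝕋 + 1`
    -- from `(𝕋 + 1)^(2n-1)`, which leaves `d = 2n - s`.
    rw [hStar, hlast, hΓ, hd, Nat.add_sub_cancel_left, show 2 * m + 1 = t + d by omega,
      mul_pow _ ((torusClass K + 1) * β)]
    ring
  refine ⟨h1, fun h => ?_, fun h => ?_, ?_⟩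
  · obtain ⟨d, hd⟩ := Nat.exists_eq_add_of_le h
    -- Now the powers of `𝕋 + 1` fall short by `d = s - 2n`; they are supplied on the left-hand
    -- side, so no cancellation in the Grothendieck ring is needed.
    have hpow : (torusClass K + 1) ^ t =
        (torusClass K + 1) ^ d * (torusClass K + 1) ^ (2 * m + 1) := by
      rw [← pow_add]
      congr 1
      omega
    rw [hStar, hlast, hΓ, show t + 1 - 2 * (m + 1) = d by omega, Nat.add_sub_cancel,
      mul_pow _ ((torusClass K + 1) * β), hpow]
    ring
  · refine ⟨Polynomial.X ^ (m + 1) * (Polynomial.X + 1) ^ (2 * (m + 1) - (t + 1)) *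
      starPoly (t + 1) (m + 1), ?_⟩
    rw [h1 h, Nat.add_sub_cancel]
    simp only [map_mul, map_pow, map_add, map_one, Polynomial.aeval_X]
    ring
  -- By `chainBG_add` with equal arguments the last factor of the class is `b (𝕋 b + 2 g)`. Dividing
  -- `𝕋^(2m+2) (𝕋 + 1)^(4m+3) b (𝕋 b + 2 g)` by `𝕌(Γ_{m+1}) = 𝕋^(m+1) (𝕋 + 1)^(2m+3) b` suggests
  -- this quotient.
  · refine ⟨Polynomial.X ^ (m + 1) * (Polynomial.X + 1) ^ (2 * m) *
      (Polynomial.X * (chainBG (m + 1)).1 + 2 * (chainBG (m + 1)).2), ?_⟩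
    refine (grothendieckClass_iterate_fourBanana K (2 * m + 1)).trans ?_
    rw [complClass_parallelEdge_genericCircle_snd, show 2 * m + 1 + 1 = m + 1 + (m + 1) by ring,
      chainBG_add, hΓ, hβ]
    simp only [map_mul, map_pow, map_add, map_one, map_ofNat, Polynomial.aeval_X]
    ring
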